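/- **Model.** $n\ge 1$ identical devices, which do not know $n$, share one channel. Time is divided into slots, and all devices start simultaneously in the same initial state. In each slot a device either transmits a message from a message space $\mathcal M$ (an arbitrary set), listens, or is idle; listening and transmitting cost one unit of energy each, idling is free. The channel carries *silence* if no device transmits, the message $m$ if exactly one device transmits $m$, and *noise* if at least two devices transmit. A listener receives this signal and an idle device receives nothing. In the *Strong-CD* model a transmitting device receives the signal too; in the *Receiver-CD* model it receives nothing. The state of a device is the list of its past actions, received signals and private coin values. An algorithm designates some states as terminal, each with an output (a device in a terminal state stops), and specifies for every other state the probability distribution of the next (private coin, action); all devices draw independently. An algorithm *solves a problem within time $T(n)$ with failure probability at most $1/n$* if for every $n\ge1$, when it is run on $n$ devices, with probability at least $1-1/n$ all devices have terminated within $T(n)$ slots and the requirement of the problem holds; in a failed execution the devices may behave arbitrarily. The requirements are: * *Approximate Counting* with constant factor $c\ge1$: all devices output the same $\tilde n$, and $n/c\le\tilde n\le cn$. * *Leader Election*: exactly one device outputs "leader" and all others "follower", and the execution of all devices ends with one slot in which the leader transmits and every follower listens. * *Contention resolution*: every device has a slot in which it is the only device that transmits. Let $\log^* n$ be the number of times $\log_2$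 has to be applied to $n$ until the result is at most $1$. For a function $T$ and $d_1\in\mathbb N$ let $d_{i+1}=T\bigl(2^{2^{2^{2^{d_i}}}}\bigr)$ for $i\ge 1$. **Theorem.** There is an absolute constant $\kappa>0$ such that the following hold in the Strong-CD model and in the Receiver-CD model. 1. Let $\mathcal A$ be a randomized algorithm that solves Approximate Counting (with any constant factor $c\ge 1$), Leader Election or contention resolution within polynomial time with failure probability at most $1/n$. Then the energy cost of $\mathcal A$ is $\Omega(\log(\log^* n))$, in the following sense: for every sufficiently large $n$ there is a network size $n'$ with $2\le n'\le n$ such that, when $\mathcal A$ is executed on $n'$ devices, with probability at least $1-n'^{-7}$ some device spends at least $\kappa\log(\log^* n)$ units of energy. 2. For every $c\ge1$ there is $D$ such that the following holds for every $d_1\ge D$. Let $T$ be a nondecreasing function with $T(n)\ge n$, and let $\mathcal A$ be an algorithm that solves Approximate Counting with factor $c$ within time $T(n)$ with failure probability at most $1/n$. Then for every integer $k\ge3$ there is a network size $n$ with $d_1\le n\le d_{k+1}$ such that, when $\mathcal A$ is executed on $n$ devices, with probability at least $1-n^{-7}$ some device spends at least $\kappa\log k$ units of energy. -/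

import Mathlib

open scoped ENNReal

universe u v w

noncomputable section

namespace RadioNet

/-- What a device can do in one time slot. -/
inductive Action (M : Type v) : Type v
  | idle : Action M
  | listen : Action M
  | transmit (m : M) : Action M

/-- The message sent, if any. -/
def Action.sent {M : Type v} : Action M → Option M
  | .transmit m => some m
  | _ => none

/-- The energy spent by an action: transmitting and listening cost one unit each. -/
def Action.cost {M : Type v} : Action M → ℕ
  | .idle => 0
  | .listen => 1
  | .transmit _ => 1

/-- The state of the channel in one time slot. -/
inductive Signal (M : Type v) : Type v
  | silence : Signal M
  | noise : Signal M
  | message (m : M) : Signal M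

/-- The state of the channel when the messages in the list are transmitted simultaneously. -/
def channel {M : Type v} : List M → Signal M
  | [] => .silence
  | [m] => .message m
  | _ :: _ :: _ => .noise

/-- The two collision-detection models in which listeners distinguish silence from noise. In
`strong` senders receive the channel signal as well, in `receiver` senders receive no signal. -/
inductive CDModel : Type
  | strong : CDModel
  | receiver : CDModel

/-- The signal received by a device that performed the given action (`none`: no signal). -/
def feedback {M : Type v} : CDModel → Signal M → Action M → Option (Signal M)
  | _, _, .idle => none
  | _, s, .listen => some s
  | .strong, s, .transmit _ => some s
  | .receiver, _, .transmit _ => none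

/-- What one device experiences in one time slot: the value of its private coin, the action it
performed, and the signal it received. -/
structure Entry (R : Type u) (M : Type v) : Type (max u v) where
  coin : R
  action : Action M
  heard : Option (Signal M)

/-- The state of a device: all it has experienced, in chronological order. The entry with index
`t` belongs to time slot `t` (slots are numbered from `0`). The empty list is the common initial
state of all devices. -/
abbrev History (R : Type u) (M : Type v) : Type (max u v) := List (Entry R M)

/-- A randomized algorithm with private coins in `R`, message space `M` and outputs in `Out`. All
devices run it, and it does not know the number of devices. A state `h` with `output h = some o`
is terminal, with output `o`; in any other state the device draws a private coin and an action
for the next time slot from the distribution `act h`. -/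
structure Algorithm (R : Type u) (M : Type v) (Out : Type w) : Type (max u v w) where
  output : History R M → Option Out
  act : History R M → PMF (R × Action M)

/-- The joint distribution of independent random variables with the given distributions. -/
def indep {α : Type u} : (n : ℕ) → (Fin n → PMF α) → PMF (Fin n → α)
  | 0, _ => PMF.pure Fin.elim0
  | n + 1, p =>
      (p 0).bind fun a => (indep n fun i => p i.succ).map fun f => Fin.cons a f

variable {R : Type u} {M : Type v} {Out : Type w} {n : ℕ}

/-- The random choice of a device in state `h`; `none` if the device has terminated. -/
def Algorithm.choice (A : Algorithm R M Out) (h : History R M) :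
    PMF (Option (R × Action M)) :=
  match A.output h with
  | some _ => PMF.pure none
  | none => (A.act h).map some

/-- The messages transmitted in a time slot, given the choices of all devices. -/
def transmissions (x : Fin n → Option (R × Action M)) : List M :=
  (List.ofFn x).filterMap fun c => c.bind fun ra => ra.2.sent

/-- The new state of a device in state `h` with the given choice, when the channel is in state
`s`. The state of a terminated device does not change any more. -/
def update (model : CDModel) (s : Signal M) (h : History R M) :
    Option (R × Action M) → History R M
  | none => h
  | some (r, a) => h ++ [⟨r, a, feedback model s a⟩]

/-- One time slot of an execution on `n` devices. -/
def Algorithm.step (A : Algorithm R M Out) (model : CDModel) (σ : Fin n → History R M) :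
    PMF (Fin n → History R M) :=
  (indep n fun i => A.choice (σ i)).map fun x i =>
    update model (channel (transmissions x)) (σ i) (x i)

/-- The distribution of the states of `n` devices after `t` time slots. -/
def Algorithm.run (A : Algorithm R M Out) (model : CDModel) (n : ℕ) :
    ℕ → PMF (Fin n → History R M)
  | 0 => PMF.pure fun _ => []
  | t + 1 => (A.run model n t).bind (A.step model)

/-- The energy spent by a device. -/
def energy (h : History R M) : ℕ := (h.map fun e => e.action.cost).sum

/-- The probability that, in an execution on `n` devices, some device spends at least `x` units
of energy. (The events "by time `t`" increase with `t`, so the supremum is the probability of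
their union over all `t`.) -/
def Algorithm.probEnergyAtLeast (A : Algorithm R M Out) (model : CDModel) (n : ℕ) (x : ℝ) :
    ℝ≥0∞ :=
  ⨆ t : ℕ, (A.run model n t).toOuterMeasure {σ | ∃ s, x ≤ (energy (σ s) : ℝ)}

/-- The device with state `h` transmitted in time slot `t`. -/
def TransmitsAt (h : History R M) (t : ℕ) : Prop :=
  ∃ e, h[t]? = some e ∧ ∃ m, e.action = .transmit m

/-- The device with state `h` listened in time slot `t`. -/
def ListensAt (h : History R M) (t : ℕ) : Prop :=
  ∃ e, h[t]? = some e ∧ e.action = .listen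

/-- A criterion that says when the final states of `n` devices, under a given algorithm, are a
successful outcome. -/
abbrev Criterion (R : Type u) (M : Type v) (Out : Type w) :=
  Algorithm R M Out → (n : ℕ) → (Fin n → History R M) → Prop

/-- Approximate Counting with approximation factor `c`: all devices have terminated, with a common
output within a factor `c` of the number of devices. -/
def ApproximateCounting (c : ℝ) : Criterion R M ℝ := fun A n σ =>
  ∃ est : ℝ, (n : ℝ) / c ≤ est ∧ est ≤ c * n ∧ ∀ s, A.output (σ s) = some est

/-- The outputs of Leader Election. -/
inductive Role : Type
  | leader : Role
  | follower : Role

/-- Leader Election: all devices have terminated, exactly one as the leader and all others as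
followers, and the last time slot is one in which the leader transmitted and every follower
listened. -/
def LeaderElection : Criterion R M Role := fun A n σ =>
  ∃ l : Fin n, A.output (σ l) = some .leader ∧ (∀ s, s ≠ l → A.output (σ s) = some .follower) ∧
    ∃ t : ℕ, (∀ s, (σ s).length = t + 1) ∧ TransmitsAt (σ l) t ∧ ∀ s, s ≠ l → ListensAt (σ s) t

/-- Contention resolution: all devices have terminated, and each device had a time slot in which
it was the only one to transmit. -/
def ContentionResolution : Criterion R M Out := fun A n σ =>
  ∀ s : Fin n, (A.output (σ s)).isSome ∧
    ∃ t : ℕ, TransmitsAt (σ s) t ∧ ∀ s', s' ≠ s → ¬ TransmitsAt (σ s') t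

/-- On `n` devices, for every `n ≥ 1`, the algorithm achieves the criterion within `T n` time
slots with failure probability at most `1 / n`. In a failed execution the devices may behave
arbitrarily. -/
def Algorithm.Solves (A : Algorithm R M Out) (model : CDModel) (P : Criterion R M Out)
    (T : ℕ → ℕ) : Prop :=
  ∀ n : ℕ, 1 ≤ n → (A.run model n (T n)).toOuterMeasure {σ | ¬ P A n σ} ≤ (n : ℝ≥0∞)⁻¹

/-- The time bound `T` is polynomial. -/
def PolyTime (T : ℕ → ℕ) : Prop := ∃ p : Polynomial ℕ, ∀ n, T n ≤ p.eval n

/-- The iterated logarithm: the number of times the binary logarithm has to be applied to `n`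
until the result is at most `1`. -/
def logStar (n : ℕ) : ℕ := sInf {k : ℕ | (Real.logb 2)^[k] (n : ℝ) ≤ 1}

/-- The energy cost is at least `f`: for all large `n` there is a network size `n' ≤ n` such that,
on `n'` devices, some device spends at least `f n` units of energy with probability at least
`1 - n' ^ (-7)`. -/
def Algorithm.EnergyCostAtLeast (A : Algorithm R M Out) (model : CDModel) (f : ℕ → ℝ) : Prop :=
  ∀ᶠ n : ℕ in Filter.atTop, ∃ n' : ℕ, 2 ≤ n' ∧ n' ≤ n ∧
    1 - ((n' : ℝ≥0∞) ^ 7)⁻¹ ≤ A.probEnergyAtLeast model n' (f n)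

/-- The checkpoints for the time bound `T` and the first checkpoint `d`, numbered from `0`. -/
def checkpoint (T : ℕ → ℕ) (d : ℕ) : ℕ → ℕ
  | 0 => d
  | i + 1 => T (2 ^ 2 ^ 2 ^ 2 ^ checkpoint T d i)

end RadioNet

end

/-!
Compare `n` devices with independent devices each of which is told, instead of the actual channel
signal, a fixed prediction. In a slot in which a device transmits with probability much below `1/n`
there is silence, and in a slot in which it transmits with probability much above `1/n` there is
noise. There are only finitely many sequences of predictions up to time `d`, hence only finitely
many transmission probabilities, so some size `n` much larger than `d` falls into a gap between
them: in a network of this size every signal before time `d` is predictable, and no lone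
transmission occurs.

Take one such size between any two consecutive checkpoints. An algorithm whose devices cannot tell
two of these sizes apart fails on one of them. A device tells them apart only by being active in a
slot in which the predictions differ or are no longer valid, and each active slot yields one bit, as
in a decision tree: after spending `e` units of energy a device can have excluded all but a fraction
`2⁻ᵉ` of the sizes. So `2 ^ E` sizes force an energy of `E` on one of them with probability at least
`2⁻ᴱ / 4` for each device; the many nearly independent devices turn this into near certainty.
-/

noncomputable section

namespace RadioNet

section Expectation

variable {α β : Type*}

/-- The expectation of a nonnegative random variable. -/
def expect (p : PMF α) (f : α → ℝ≥0∞) : ℝ≥0∞ := ∑' a, p a * f a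

/-- The probability of the event `P`. -/
def prob (p : PMF α) (P : α → Prop) : ℝ≥0∞ := p.toOuterMeasure {a | P a}

theorem expect_pure (a : α) (f : α → ℝ≥0∞) : expect (PMF.pure a) f = f a := by
  rw [expect, tsum_eq_single a fun b hb => by simp [hb]]
  simp

theorem expect_bind (p : PMF α) (q : α → PMF β) (f : β → ℝ≥0∞) :
    expect (p.bind q) f = expect p fun a => expect (q a) f := by
  simp only [expect, PMF.bind_apply, ← ENNReal.tsum_mul_right, ← ENNReal.tsum_mul_left]
  rw [ENNReal.tsum_comm]
  simp only [mul_assoc]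

theorem expect_map (p : PMF α) (u : α → β) (f : β → ℝ≥0∞) :
    expect (p.map u) f = expect p fun a => f (u a) := by
  simp [← PMF.bind_pure_comp, expect_bind, expect_pure]

theorem expect_mono_support {p : PMF α} {f g : α → ℝ≥0∞} (h : ∀ a ∈ p.support, f a ≤ g a) :
    expect p f ≤ expect p g := by
  refine ENNReal.tsum_le_tsum fun a => ?_
  by_cases ha : a ∈ p.support
  · gcongr
    exact h a ha
  · simp [(p.apply_eq_zero_iff a).2 ha]

theorem expect_mono {p : PMF α} {f g : α → ℝ≥0∞} (h : ∀ a, f a ≤ g a) :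
    expect p f ≤ expect p g :=
  expect_mono_support fun a _ => h a

theorem expect_congr_support {p : PMF α} {f g : α → ℝ≥0∞} (h : ∀ a ∈ p.support, f a = g a) :
    expect p f = expect p g :=
  le_antisymm (expect_mono_support fun a ha => (h a ha).le)
    (expect_mono_support fun a ha => (h a ha).ge)

theorem expect_const (p : PMF α) (c : ℝ≥0∞) : expect p (fun _ => c) = c := by
  rw [expect, ENNReal.tsum_mul_right, p.tsum_coe, one_mul]

theorem expect_add (p : PMF α) (f g : α → ℝ≥0∞) :
    expect p (fun a => f a + g a) = expect p f + expect p g := by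
  simp only [expect, mul_add, ENNReal.tsum_add]

theorem expect_mul_right (p : PMF α) (f : α → ℝ≥0∞) (c : ℝ≥0∞) :
    expect p (fun a => f a * c) = expect p f * c := by
  simp only [expect, ← mul_assoc, ENNReal.tsum_mul_right]

theorem expect_sum {ι : Type*} (p : PMF α) (s : Finset ι) (f : ι → α → ℝ≥0∞) :
    expect p (fun a => ∑ i ∈ s, f i a) = ∑ i ∈ s, expect p (f i) := by
  classical
  induction s using Finset.induction_on with
  | empty => simp [expect_const]
  | insert i s hi ih => simp only [Finset.sum_insert hi, expect_add, ih]

theorem expect_le_one {p : PMF α} {f : α → ℝ≥0∞} (h : ∀ a, f a ≤ 1) :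
    expect p f ≤ 1 :=
  (expect_mono h).trans (expect_const p 1).le

theorem one_le_expect {p : PMF α} {f : α → ℝ≥0∞} (h : ∀ a ∈ p.support, 1 ≤ f a) :
    1 ≤ expect p f :=
  (expect_const p 1).ge.trans (expect_mono_support h)

theorem prob_eq_expect_ite (p : PMF α) (P : α → Prop) [DecidablePred P] :
    prob p P = expect p fun a => if P a then 1 else 0 := by
  rw [prob, PMF.toOuterMeasure_apply]
  refine tsum_congr fun a => ?_
  by_cases h : P a <;> simp [h]

theorem prob_mono {p : PMF α} {P Q : α → Prop} (h : ∀ a ∈ p.support, P a → Q a) :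
    prob p P ≤ prob p Q :=
  p.toOuterMeasure_mono fun a ha => h a ha.2 ha.1

theorem prob_eq_one {p : PMF α} {P : α → Prop} (h : ∀ a ∈ p.support, P a) : prob p P = 1 :=
  (p.toOuterMeasure_apply_eq_one_iff _).2 h

theorem prob_or_le (p : PMF α) (P Q : α → Prop) :
    prob p (fun a => P a ∨ Q a) ≤ prob p P + prob p Q :=
  MeasureTheory.measure_union_le (μ := p.toOuterMeasure) {a | P a} {a | Q a}

theorem prob_exists_le {ι : Type*} [Fintype ι] (p : PMF α) (P : ι → α → Prop) :
    prob p (fun a => ∃ i, P i a) ≤ ∑ i, prob p (P i) := by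
  simpa only [prob, Set.ofPred_exists] using
    MeasureTheory.measure_iUnion_fintype_le p.toOuterMeasure fun i => {a | P i a}

theorem prob_add_prob_not (p : PMF α) (P : α → Prop) :
    prob p P + prob p (fun a => ¬ P a) = 1 := by
  classical
  rw [prob_eq_expect_ite, prob_eq_expect_ite, ← expect_add]
  refine .trans (congrArg (expect p) (funext fun a => ?_)) (expect_const p 1)
  by_cases h : P a <;> simp [h]

theorem prob_le_one (p : PMF α) (P : α → Prop) : prob p P ≤ 1 :=
  le_self_add.trans (prob_add_prob_not p P).le

theorem prob_pure_of_not {a : α} {P : α → Prop} (h : ¬ P a) : prob (PMF.pure a) P = 0 := by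
  simp [prob, h]

theorem prob_bind (p : PMF α) (q : α → PMF β) (P : β → Prop) :
    prob (p.bind q) P = expect p fun a => prob (q a) P :=
  PMF.toOuterMeasure_bind_apply p q _

theorem prob_map (p : PMF α) (u : α → β) (P : β → Prop) :
    prob (p.map u) P = prob p fun a => P (u a) :=
  PMF.toOuterMeasure_map_apply u p _

theorem expect_le_expect_add_prob {p : PMF α} {f g : α → ℝ≥0∞} (hf : ∀ a, f a ≤ 1)
    {bad : α → Prop} (h : ∀ a ∈ p.support, ¬ bad a → f a ≤ g a) :
    expect p f ≤ expect p g + prob p bad := by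
  classical
  rw [prob_eq_expect_ite, ← expect_add]
  refine expect_mono_support fun a ha => ?_
  by_cases hb : bad a
  · simpa [hb] using (hf a).trans le_add_self
  · simpa [hb] using h a ha hb

end Expectation

section Independence

variable {α : Type u} {β : Type v} {n : ℕ}

theorem indep_succ (p : Fin (n + 1) → PMF α) :
    indep (n + 1) p =
      (p 0).bind fun a => (indep n fun i => p i.succ).map fun x => Fin.cons a x :=
  rfl

theorem indep_bind (p : Fin n → PMF α) (q : Fin n → α → PMF β) :
    ((indep n p).bind fun x => indep n fun i => q i (x i)) =
      indep n fun i => (p i).bind (q i) := by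
  induction n with
  | zero => simp [indep]
  | succ n ih =>
    simp only [indep_succ, PMF.bind_bind, PMF.bind_map, Function.comp_def, Fin.cons_zero,
      Fin.cons_succ]
    refine congrArg (p 0).bind (funext fun a => ?_)
    rw [PMF.bind_comm]
    refine congrArg (q 0 a).bind (funext fun b => ?_)
    rw [← ih (fun i => p i.succ) fun i => q i.succ, PMF.map_bind]

theorem indep_pure (a : Fin n → α) : (indep n fun i => PMF.pure (a i)) = PMF.pure a := by
  induction n with
  | zero => exact congrArg PMF.pure (Subsingleton.elim _ _)
  | succ n ih =>
    rw [indep_succ, PMF.pure_bind, ih fun i => a i.succ, PMF.pure_map]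
    exact congrArg PMF.pure (Fin.cons_self_tail a)

theorem indep_map (p : Fin n → PMF α) (u : Fin n → α → β) :
    ((indep n p).map fun x i => u i (x i)) = indep n fun i => (p i).map (u i) := by
  have h := indep_bind p fun i a => PMF.pure (u i a)
  simp only [indep_pure] at h
  exact h

theorem indep_map_apply (p : Fin n → PMF α) (i : Fin n) :
    ((indep n p).map fun x => x i) = p i := by
  induction n with
  | zero => exact i.elim0
  | succ n ih =>
    rw [indep_succ, PMF.map_bind]
    simp only [PMF.map_comp, Function.comp_def]
    cases i using Fin.cases with
    | zero =>
      exact (congrArg (p 0).bind (funext fun a => PMF.map_const _ a)).trans (PMF.bind_pure _)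
    | succ i => simp [ih]

theorem mem_support_indep {p : Fin n → PMF α} {x : Fin n → α} (h : x ∈ (indep n p).support)
    (i : Fin n) : x i ∈ (p i).support := by
  rw [← indep_map_apply p i, PMF.support_map]
  exact ⟨x, h, rfl⟩

theorem prob_indep_apply (p : Fin n → PMF α) (i : Fin n) (Q : α → Prop) :
    prob (indep n p) (fun x => Q (x i)) = prob (p i) Q := by
  rw [← prob_map (indep n p) fun x => x i, indep_map_apply]

theorem prob_indep_forall (p : PMF α) (Q : α → Prop) :
    prob (indep n fun _ => p) (fun x => ∀ i, Q (x i)) = prob p Q ^ n := by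
  classical
  induction n with
  | zero => exact (prob_eq_one fun _ _ i => i.elim0).trans (pow_zero _).symm
  | succ n ih =>
    rw [indep_succ, prob_bind, pow_succ', ← ih, prob_eq_expect_ite p, ← expect_mul_right]
    refine congrArg (expect p) (funext fun a => ?_)
    rw [prob_map]
    by_cases ha : Q a
    · simp [Fin.forall_fin_succ, ha]
    · simp [Fin.forall_fin_succ, ha, prob]

end Independence

section Transmissions

variable {R : Type u} {M : Type v} {n : ℕ}

/-- The random choice of a device is to transmit. -/
def Sends (c : Option (R × Action M)) : Prop := (c.bind fun ra => ra.2.sent) ≠ none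

theorem not_sends_none : ¬ Sends (none : Option (R × Action M)) := fun h => h rfl

theorem sends_some {r : R} {a : Action M} :
    Sends (some (r, a)) ↔ ∃ m, a = .transmit m := by
  cases a <;> simp [Sends, Action.sent]

theorem length_transmissions_cons_of_sends {c : Option (R × Action M)} (hc : Sends c)
    (x : Fin n → Option (R × Action M)) :
    (transmissions (Fin.cons c x : Fin (n + 1) → _)).length = (transmissions x).length + 1 := by
  obtain ⟨m, hm⟩ := Option.ne_none_iff_exists'.1 hc
  simp [transmissions, hm]

theorem transmissions_cons_of_not_sends {c : Option (R × Action M)} (hc : ¬ Sends c)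
    (x : Fin n → Option (R × Action M)) :
    transmissions (Fin.cons c x : Fin (n + 1) → _) = transmissions x := by
  simp [transmissions, not_not.1 hc]

theorem transmissions_eq_nil_iff {x : Fin n → Option (R × Action M)} :
    transmissions x = [] ↔ ∀ i, ¬ Sends (x i) := by
  simp [transmissions, Sends, List.filterMap_eq_nil_iff, List.mem_ofFn]

theorem length_transmissions_eq_one {x : Fin n → Option (R × Action M)} {s : Fin n}
    (hs : Sends (x s)) (hs' : ∀ s', s' ≠ s → ¬ Sends (x s')) :
    (transmissions x).length = 1 := by
  induction n with
  | zero => exact s.elim0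
  | succ n ih =>
    rw [← Fin.cons_self_tail x]
    cases s using Fin.cases with
    | zero =>
      rw [length_transmissions_cons_of_sends hs,
        (transmissions_eq_nil_iff (x := Fin.tail x)).2 fun i => hs' _ (Fin.succ_ne_zero i),
        List.length_nil]
    | succ s =>
      rw [transmissions_cons_of_not_sends (hs' 0 (Fin.succ_ne_zero s).symm)]
      exact ih hs fun s' h => hs' _ ((Fin.succ_injective n).ne h)

theorem prob_transmissions_ne_nil_le (p : PMF (Option (R × Action M))) :
    prob (indep n fun _ => p) (fun x => transmissions x ≠ []) ≤ n * prob p Sends := by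
  calc prob (indep n fun _ => p) (fun x => transmissions x ≠ [])
      ≤ prob (indep n fun _ => p) (fun x => ∃ i, Sends (x i)) :=
        prob_mono fun x _ hx => by simpa [transmissions_eq_nil_iff] using hx
    _ ≤ ∑ i : Fin n, prob (indep n fun _ => p) (fun x => Sends (x i)) := prob_exists_le _ _
    _ = n * prob p Sends := by simp [prob_indep_apply]

theorem prob_length_transmissions_le_one (p : PMF (Option (R × Action M))) (n : ℕ) :
    prob (indep (n + 1) fun _ => p) (fun x => (transmissions x).length ≤ 1) ≤
      (n + 1) * prob p (fun c => ¬ Sends c) ^ n := by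
  classical
  induction n with
  | zero => simpa using prob_le_one _ _
  | succ n ih =>
    set q := prob p fun c => ¬ Sends c
    have first_choice (c : Option (R × Action M)) :
        prob (indep (n + 1) fun _ => p)
            (fun x => (transmissions (Fin.cons c x : Fin (n + 2) → _)).length ≤ 1) ≤
          (if ¬ Sends c then 1 else 0) * ((n + 1) * q ^ n) + q ^ (n + 1) := by
      by_cases hc : Sends c
      · simp [length_transmissions_cons_of_sends hc, transmissions_eq_nil_iff, hc,
          prob_indep_forall p fun c => ¬ Sends c, q]
      · simpa [transmissions_cons_of_not_sends hc, hc] using le_add_right ih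
    rw [indep_succ, prob_bind]
    simp only [prob_map]
    refine (expect_mono first_choice).trans (le_of_eq ?_)
    rw [expect_add, expect_mul_right, expect_const, ← prob_eq_expect_ite]
    push_cast
    ring

theorem channel_eq_silence_iff {l : List M} : channel l = .silence ↔ l = [] := by
  rcases l with _ | ⟨a, _ | ⟨b, l⟩⟩ <;> simp [channel]

theorem channel_eq_noise_iff {l : List M} : channel l = .noise ↔ ¬ l.length ≤ 1 := by
  rcases l with _ | ⟨a, _ | ⟨b, l⟩⟩ <;> simp [channel]

end Transmissions

section Histories

variable {R : Type u} {M : Type v} {Out : Type w} {n : ℕ}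

theorem length_update_le (model : CDModel) (s : Signal M) (h : History R M)
    (c : Option (R × Action M)) : (update model s h c).length ≤ h.length + 1 := by
  rcases c with _ | ⟨r, a⟩ <;> simp [update]

theorem update_idle (model : CDModel) (s s' : Signal M) (h : History R M) (r : R) :
    update model s h (some (r, .idle)) = update model s' h (some (r, .idle)) := by
  cases model <;> rfl

theorem TransmitsAt.lt_length {h : History R M} {t : ℕ} (ht : TransmitsAt h t) :
    t < h.length := by
  obtain ⟨e, he, -⟩ := ht
  exact (List.getElem?_eq_some_iff.1 he).1

theorem getElem?_append_singleton_eq_some_iff {α : Type*} {l : List α} {a b : α} {t : ℕ} :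
    (l ++ [a])[t]? = some b ↔ l[t]? = some b ∨ (t = l.length ∧ a = b) := by
  rcases lt_trichotomy t l.length with h | rfl | h
  · simp [List.getElem?_append_left h, h.ne]
  · simp
  · simp [List.getElem?_eq_none, h.le, h.ne', Nat.succ_le_of_lt h]

theorem transmitsAt_update_iff {model : CDModel} {s : Signal M} {h : History R M}
    {c : Option (R × Action M)} {t : ℕ} :
    TransmitsAt (update model s h c) t ↔ TransmitsAt h t ∨ (t = h.length ∧ Sends c) := by
  rcases c with _ | ⟨r, a⟩
  · simp [update, not_sends_none]
  · simp only [update, TransmitsAt, getElem?_append_singleton_eq_some_iff, or_and_right,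
      exists_or, sends_some]
    aesop

/-- The state `h` is possible after `t` time slots: it has one entry per slot, until the device
terminates. -/
def Algorithm.OnTime (A : Algorithm R M Out) (t : ℕ) (h : History R M) : Prop :=
  h.length ≤ t ∧ (A.output h = none → h.length = t)

variable {A : Algorithm R M Out} {model : CDModel}

theorem Algorithm.choice_of_terminal {h : History R M} (hh : A.output h ≠ none) :
    A.choice h = PMF.pure none := by
  obtain ⟨o, ho⟩ := Option.ne_none_iff_exists'.1 hh
  simp [choice, ho]

theorem Algorithm.choice_of_not_terminal {h : History R M} (hh : A.output h = none) :
    A.choice h = (A.act h).map some := by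
  simp [choice, hh]

theorem Algorithm.eq_none_of_mem_support_choice {h : History R M} {c : Option (R × Action M)}
    (hc : c ∈ (A.choice h).support) (hh : A.output h ≠ none) : c = none := by
  simpa [choice_of_terminal hh] using hc

theorem Algorithm.OnTime.update {t : ℕ} {h : History R M} (hh : A.OnTime t h) (s : Signal M)
    {c : Option (R × Action M)} (hc : c ∈ (A.choice h).support) :
    A.OnTime (t + 1) (update model s h c) := by
  by_cases ho : A.output h = none
  · obtain ⟨ra, -, rfl⟩ := (PMF.mem_support_map_iff _ _ _).1 (choice_of_not_terminal ho ▸ hc)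
    simp [OnTime, RadioNet.update, hh.2 ho]
  · obtain rfl := eq_none_of_mem_support_choice hc ho
    exact ⟨hh.1.trans t.le_succ, fun h' => absurd h' ho⟩

theorem Algorithm.OnTime.length_eq {t : ℕ} {h : History R M} (hh : A.OnTime t h)
    {ra : R × Action M} (hc : some ra ∈ (A.choice h).support) : h.length = t :=
  hh.2 <| by_contra fun ho => nomatch eq_none_of_mem_support_choice hc ho

theorem Algorithm.OnTime.length_eq_of_sends {t : ℕ} {h : History R M} (hh : A.OnTime t h)
    {c : Option (R × Action M)} (hc : c ∈ (A.choice h).support) (hs : Sends c) :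
    h.length = t := by
  cases c with
  | none => exact absurd hs not_sends_none
  | some ra => exact hh.length_eq hc

theorem exists_of_mem_support_step {σ σ' : Fin n → History R M}
    (h : σ' ∈ (A.step model σ).support) :
    ∃ x : Fin n → Option (R × Action M), (∀ i, x i ∈ (A.choice (σ i)).support) ∧
      σ' = fun i => update model (channel (transmissions x)) (σ i) (x i) := by
  obtain ⟨x, hx, rfl⟩ := (PMF.mem_support_map_iff _ _ _).1 h
  exact ⟨x, mem_support_indep hx, rfl⟩

theorem onTime_of_mem_support_run {t : ℕ} {σ : Fin n → History R M}
    (h : σ ∈ (A.run model n t).support) (i : Fin n) : A.OnTime t (σ i) := by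
  induction t generalizing σ with
  | zero =>
    obtain rfl : σ = fun _ => [] := by simpa [Algorithm.run] using h
    simp [Algorithm.OnTime]
  | succ t ih =>
    obtain ⟨σ₀, hσ₀, hstep⟩ := (PMF.mem_support_bind_iff _ _ _).1 h
    obtain ⟨x, hx, rfl⟩ := exists_of_mem_support_step hstep
    exact (ih hσ₀).update _ (hx i)

theorem eq_of_mem_support_step_of_terminal {σ σ' : Fin n → History R M}
    (h : σ' ∈ (A.step model σ).support) {i : Fin n} (hi : A.output (σ i) ≠ none) :
    σ' i = σ i := by
  obtain ⟨x, hx, rfl⟩ := exists_of_mem_support_step h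
  simp only [Algorithm.eq_none_of_mem_support_choice (hx i) hi, update]

theorem monotone_prob_run {W : (Fin n → History R M) → Prop}
    (hW : ∀ σ, W σ → ∀ σ' ∈ (A.step model σ).support, W σ') :
    Monotone fun t => prob (A.run model n t) W := by
  classical
  refine monotone_nat_of_le_succ fun t => ?_
  rw [Algorithm.run, prob_bind, prob_eq_expect_ite]
  refine expect_mono fun σ => ?_
  by_cases h : W σ
  · simp [h, prob_eq_one (hW σ h)]
  · simp [h]

end Histories

section SoloDevice

variable {R : Type u} {M : Type v} {Out : Type w}

/-- The signal predicted by a bit: noise for `true`, silence for `false`. -/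
def bitSignal (b : Bool) : Signal M := if b then .noise else .silence

/-- One time slot of a device that receives the signal predicted by `F` for that slot. -/
def Algorithm.soloStep (A : Algorithm R M Out) (model : CDModel) (F : ℕ → Bool)
    (h : History R M) : PMF (History R M) :=
  (A.choice h).map (update model (bitSignal (F h.length)) h)

/-- `t` time slots, starting in state `h`, of a device that receives the signals predicted by
`F`. -/
def Algorithm.soloRun (A : Algorithm R M Out) (model : CDModel) (F : ℕ → Bool) :
    ℕ → History R M → PMF (History R M)
  | 0, h => PMF.pure h
  | t + 1, h => (A.soloStep model F h).bind (A.soloRun model F t)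

/-- The random choice in time slot `t` of a device that received the signals predicted by `F` in
all earlier slots. -/
def Algorithm.soloChoice (A : Algorithm R M Out) (model : CDModel) (F : ℕ → Bool) (t : ℕ) :
    PMF (Option (R × Action M)) :=
  (A.soloRun model F t []).bind A.choice

variable {A : Algorithm R M Out} {model : CDModel} {F F' : ℕ → Bool}

theorem soloRun_succ (t : ℕ) (h : History R M) :
    A.soloRun model F (t + 1) h = (A.soloRun model F t h).bind (A.soloStep model F) := by
  induction t generalizing h with
  | zero => simp [Algorithm.soloRun]
  | succ t ih =>
    calc A.soloRun model F (t + 1 + 1) h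
        = (A.soloStep model F h).bind fun h' =>
            (A.soloRun model F t h').bind (A.soloStep model F) := by rw [← funext ih]; rfl
      _ = (A.soloRun model F (t + 1) h).bind (A.soloStep model F) := (PMF.bind_bind _ _ _).symm

theorem soloRun_congr {t : ℕ} {h : History R M} (hF : ∀ i < h.length + t, F i = F' i) :
    A.soloRun model F t h = A.soloRun model F' t h := by
  induction t generalizing h with
  | zero => rfl
  | succ t ih =>
    simp only [Algorithm.soloRun, Algorithm.soloStep, hF h.length (by omega), PMF.bind_map]
    refine congrArg (A.choice h).bind (funext fun c => ih fun i hi => hF i ?_)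
    have := length_update_le model (bitSignal (F' h.length)) h c
    omega

theorem soloChoice_congr {t : ℕ} (hF : ∀ i < t, F i = F' i) :
    A.soloChoice model F t = A.soloChoice model F' t := by
  rw [Algorithm.soloChoice, soloRun_congr (by simpa using hF), Algorithm.soloChoice]

theorem soloRun_of_terminal {h : History R M} (hh : A.output h ≠ none) (t : ℕ) :
    A.soloRun model F t h = PMF.pure h := by
  induction t with
  | zero => rfl
  | succ t ih =>
    rw [Algorithm.soloRun, Algorithm.soloStep, Algorithm.choice_of_terminal hh, PMF.pure_map,
      PMF.pure_bind]
    exact ih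

theorem onTime_of_mem_support_soloRun {t : ℕ} {h : History R M}
    (hh : h ∈ (A.soloRun model F t []).support) : A.OnTime t h := by
  induction t generalizing h with
  | zero =>
    obtain rfl : h = [] := by simpa [Algorithm.soloRun] using hh
    simp [Algorithm.OnTime]
  | succ t ih =>
    rw [soloRun_succ] at hh
    obtain ⟨h₀, hh₀, hstep⟩ := (PMF.mem_support_bind_iff _ _ _).1 hh
    obtain ⟨c, hc, rfl⟩ := (PMF.mem_support_map_iff _ _ _).1 hstep
    exact (ih hh₀).update _ hc

/-- A device in state `h` cannot have noticed whether the signals before slot `d` followed the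
prediction `F` or `F'`: it was idle in all slots from `d` on, and in all slots in which the
predictions differ. -/
def Oblivious (F F' : ℕ → Bool) (d : ℕ) (h : History R M) : Prop :=
  ∀ t e, h[t]? = some e → e.action = .idle ∨ (t < d ∧ F t = F' t)

variable {d : ℕ}

theorem oblivious_append_singleton_iff {h : History R M} {e : Entry R M} :
    Oblivious F F' d (h ++ [e]) ↔ Oblivious F F' d h ∧
      (e.action = .idle ∨ (h.length < d ∧ F h.length = F' h.length)) := by
  simp only [Oblivious, getElem?_append_singleton_eq_some_iff]
  constructor
  · exact fun H => ⟨fun t e' he => H t e' (.inl he), H _ _ (.inr ⟨rfl, rfl⟩)⟩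
  · rintro ⟨H, H'⟩ t e' (he | ⟨rfl, rfl⟩)
    exacts [H t e' he, H']

theorem Oblivious.of_update {h : History R M} {s : Signal M} {c : Option (R × Action M)}
    (H : Oblivious F F' d (update model s h c)) : Oblivious F F' d h := by
  rcases c with _ | ⟨r, a⟩
  exacts [H, (oblivious_append_singleton_iff.1 H).1]

theorem apply_update_eq_of_oblivious {h : History R M} {s s' : Signal M}
    (hs : h.length < d → F h.length = F' h.length → s = s') {f : History R M → ℝ≥0∞}
    (hf : ∀ h, ¬ Oblivious F F' d h → f h = 0) (c : Option (R × Action M)) :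
    f (update model s h c) = f (update model s' h c) := by
  rcases c with _ | ⟨r, a⟩
  · rfl
  · by_cases ha : a = .idle
    · rw [ha, update_idle]
    · by_cases hh : h.length < d ∧ F h.length = F' h.length
      · rw [hs hh.1 hh.2]
      · rw [hf, hf] <;> simp [update, oblivious_append_singleton_iff, ha, hh]

theorem expect_soloStep_eq_zero {G : ℕ → Bool} {f : History R M → ℝ≥0∞}
    (hf : ∀ h, ¬ Oblivious F F' d h → f h = 0) {h : History R M} (hh : ¬ Oblivious F F' d h) :
    expect (A.soloStep model G h) f = 0 := by
  rw [Algorithm.soloStep, expect_map, ← expect_const (A.choice h) 0]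
  exact congrArg (expect _) (funext fun c => hf _ fun H => hh H.of_update)

theorem expect_soloRun_eq_of_oblivious (t : ℕ) {f : History R M → ℝ≥0∞}
    (hf : ∀ h, ¬ Oblivious F F' d h → f h = 0) :
    expect (A.soloRun model F t []) f = expect (A.soloRun model F' t []) f := by
  induction t generalizing f with
  | zero => rfl
  | succ t ih =>
    have step_eq : (fun h => expect (A.soloStep model F h) f) =
        fun h => expect (A.soloStep model F' h) f := by
      funext h
      simp only [Algorithm.soloStep, expect_map]
      exact congrArg (expect _) (funext fun c =>
        apply_update_eq_of_oblivious (fun _ hF => congrArg bitSignal hF) hf c)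
    rw [soloRun_succ, soloRun_succ, expect_bind, expect_bind, step_eq]
    exact ih fun h hh => expect_soloStep_eq_zero hf hh

end SoloDevice

section Coupling

variable {R : Type u} {M : Type v} {Out : Type w} {n : ℕ}

/-- In each slot before `d`, `n` independent devices that received the signals predicted by `F` so
far produce the next predicted signal, up to an error probability `ε`. -/
def Predicts (A : Algorithm R M Out) (model : CDModel) (n d : ℕ) (F : ℕ → Bool) (ε : ℝ≥0∞) :
    Prop :=
  ∀ t < d, prob (indep n fun _ => A.soloChoice model F t)
    (fun x => channel (transmissions x) ≠ bitSignal (F t)) ≤ ε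

variable {A : Algorithm R M Out} {model : CDModel} {d : ℕ} {F : ℕ → Bool} {ε : ℝ≥0∞}

theorem expect_step_le {t : ℕ} {σ : Fin n → History R M} (hσ : ∀ i, A.OnTime t (σ i))
    {g : (Fin n → History R M) → ℝ≥0∞} (hg : ∀ σ, g σ ≤ 1) :
    expect (A.step model σ) g ≤ expect (indep n fun i => A.soloStep model F (σ i)) g +
      prob (indep n fun i => A.choice (σ i))
        (fun x => channel (transmissions x) ≠ bitSignal (F t)) := by
  have solo_eq : (indep n fun i => A.soloStep model F (σ i)) =
      (indep n fun i => A.choice (σ i)).map fun x i =>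
        update model (bitSignal (F (σ i).length)) (σ i) (x i) :=
    (indep_map (fun i => A.choice (σ i)) _).symm
  rw [Algorithm.step, solo_eq, expect_map, expect_map]
  refine expect_le_expect_add_prob (fun _ => hg _) fun x hx hsignal => le_of_eq ?_
  refine congrArg g (funext fun i => ?_)
  rw [not_not.1 hsignal]
  cases hxi : x i with
  | none => rfl
  | some ra => rw [(hσ i).length_eq (hxi ▸ mem_support_indep hx i)]

theorem Predicts.expect_run_le (hP : Predicts A model n d F ε) {t : ℕ} (ht : t ≤ d)
    {g : (Fin n → History R M) → ℝ≥0∞} (hg : ∀ σ, g σ ≤ 1) :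
    expect (A.run model n t) g ≤
      expect (indep n fun _ => A.soloRun model F t []) g + t * ε := by
  induction t generalizing g with
  | zero => simp [Algorithm.run, Algorithm.soloRun, indep_pure]
  | succ t ih =>
    have solo_step :
        expect (indep n fun _ => A.soloRun model F t []) (fun σ => expect (A.step model σ) g) ≤
          expect (indep n fun _ => A.soloRun model F (t + 1) []) g + ε := by
      refine (expect_mono_support fun σ hσ => expect_step_le (F := F) (t := t) (fun i =>
        onTime_of_mem_support_soloRun (mem_support_indep hσ i)) hg).trans ?_
      rw [expect_add, ← expect_bind, ← prob_bind,
        indep_bind _ fun _ => A.soloStep model F, indep_bind _ fun _ => A.choice]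
      simp only [← soloRun_succ]
      exact add_le_add_right (hP t ht) _
    calc expect (A.run model n (t + 1)) g
        = expect (A.run model n t) (fun σ => expect (A.step model σ) g) := by
          rw [Algorithm.run, expect_bind]
      _ ≤ expect (indep n fun _ => A.soloRun model F t [])
            (fun σ => expect (A.step model σ) g) + t * ε :=
          ih (by omega) fun σ => expect_le_one hg
      _ ≤ expect (indep n fun _ => A.soloRun model F (t + 1) []) g + ε + t * ε := by gcongr
      _ = expect (indep n fun _ => A.soloRun model F (t + 1) []) g + (t + 1 : ℕ) * ε := by
          push_cast; ring

theorem Predicts.le_expect_run (hP : Predicts A model n d F ε) {t : ℕ} (ht : t ≤ d)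
    {g : (Fin n → History R M) → ℝ≥0∞} (hg : ∀ σ, g σ ≤ 1) :
    expect (indep n fun _ => A.soloRun model F t []) g ≤
      expect (A.run model n t) g + t * ε := by
  have expect_add_compl (p : PMF (Fin n → History R M)) :
      expect p g + expect p (fun σ => 1 - g σ) = 1 := by
    simp only [← expect_add, add_tsub_cancel_of_le (hg _), expect_const]
  set p := indep n fun _ => A.soloRun model F t []
  have compl_ne_top : expect p (fun σ => 1 - g σ) ≠ ⊤ :=
    ((expect_le_one fun σ => tsub_le_self).trans_lt ENNReal.one_lt_top).ne
  rw [← ENNReal.add_le_add_iff_right compl_ne_top]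
  calc expect p g + expect p (fun σ => 1 - g σ)
      = expect (A.run model n t) g + expect (A.run model n t) (fun σ => 1 - g σ) := by
        rw [expect_add_compl, expect_add_compl]
    _ ≤ expect (A.run model n t) g + (expect p (fun σ => 1 - g σ) + t * ε) := by
        gcongr
        exact hP.expect_run_le ht fun σ => tsub_le_self
    _ = expect (A.run model n t) g + t * ε + expect p (fun σ => 1 - g σ) := by ring

theorem Predicts.prob_runChoices_le (hP : Predicts A model n d F ε) {t : ℕ} (ht : t < d) :
    prob ((A.run model n t).bind fun σ => indep n fun i => A.choice (σ i))
      (fun x => channel (transmissions x) ≠ bitSignal (F t)) ≤ d * ε := by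
  rw [prob_bind]
  refine (hP.expect_run_le ht.le fun σ => prob_le_one _ _).trans ?_
  rw [← prob_bind, indep_bind _ fun _ => A.choice]
  calc _ ≤ ε + t * ε := add_le_add_left (hP t ht) _
    _ = (t + 1 : ℕ) * ε := by push_cast; ring
    _ ≤ d * ε := by gcongr; exact ht

/-- From slot `d` on an oblivious device is idle, so its choices no longer depend on the actual
signals, which need not follow the prediction any more. -/
theorem Predicts.expect_oblivious_le (hP : Predicts A model n d F ε) {F' : ℕ → Bool} {t : ℕ}
    (ht : d ≤ t) (s : Fin n) {f : History R M → ℝ≥0∞} (hf1 : ∀ h, f h ≤ 1)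
    (hf : ∀ h, ¬ Oblivious F F' d h → f h = 0) :
    expect (A.soloRun model F t []) f ≤
      expect (A.run model n t) (fun σ => f (σ s)) + d * ε := by
  induction t, ht using Nat.le_induction generalizing f with
  | base =>
    rw [← indep_map_apply (fun _ => A.soloRun model F d []) s, expect_map]
    exact hP.le_expect_run le_rfl fun σ => hf1 (σ s)
  | succ t ht ih =>
    rw [soloRun_succ, expect_bind, Algorithm.run, expect_bind]
    refine (ih (fun h => expect_le_one hf1) fun h hh => expect_soloStep_eq_zero hf hh).trans ?_
    refine add_le_add_left (le_of_eq (expect_congr_support fun σ hσ => ?_)) _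
    rw [Algorithm.soloStep, expect_map, Algorithm.step, expect_map,
      ← indep_map_apply (fun i => A.choice (σ i)) s, expect_map]
    refine expect_congr_support fun x hx => ?_
    change f (update model _ (σ s) (x s)) = f (update model _ (σ s) (x s))
    cases hxs : x s with
    | none => rfl
    | some ra =>
      have on_time : (σ s).length = t :=
        (onTime_of_mem_support_run hσ s).length_eq (hxs ▸ mem_support_indep hx s)
      exact apply_update_eq_of_oblivious (fun hlt => by omega) hf (some ra)

/-- In some slot before `d` exactly one device transmitted. -/
def LoneTransmissionBefore (d : ℕ) (σ : Fin n → History R M) : Prop :=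
  ∃ t < d, ∃ s, TransmitsAt (σ s) t ∧ ∀ s', s' ≠ s → ¬ TransmitsAt (σ s') t

theorem not_loneTransmissionBefore_nil :
    ¬ LoneTransmissionBefore d (fun _ : Fin n => ([] : History R M)) := by
  rintro ⟨t, -, s, hs, -⟩
  simpa using hs.lt_length

theorem LoneTransmissionBefore.of_update {t : ℕ} {σ : Fin n → History R M}
    {x : Fin n → Option (R × Action M)} (hσ : ∀ i, A.OnTime t (σ i))
    (hx : ∀ i, x i ∈ (A.choice (σ i)).support) {signal : Signal M}
    (h : LoneTransmissionBefore d fun i => update model signal (σ i) (x i)) :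
    LoneTransmissionBefore d σ ∨ (t < d ∧ (transmissions x).length = 1) := by
  obtain ⟨t', ht', s, hs, hs'⟩ := h
  simp only [transmitsAt_update_iff] at hs hs'
  by_cases htt : t' = t
  · subst htt
    have no_transmission (i) : ¬ TransmitsAt (σ i) t' := fun hi =>
      hi.lt_length.not_ge (hσ i).1
    refine .inr ⟨ht', length_transmissions_eq_one (hs.resolve_left (no_transmission s)).2 ?_⟩
    exact fun i hi hsends =>
      hs' i hi (.inr ⟨((hσ i).length_eq_of_sends (hx i) hsends).symm, hsends⟩)
  · refine .inl ⟨t', ht', s, hs.resolve_right ?_, fun i hi H => hs' i hi (.inl H)⟩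
    rintro ⟨hlength, hsends⟩
    exact htt (hlength.trans ((hσ s).length_eq_of_sends (hx s) hsends))

theorem channel_ne_bitSignal {l : List M} (hl : l.length = 1) (b : Bool) :
    channel l ≠ bitSignal b := by
  obtain ⟨m, rfl⟩ := List.length_eq_one_iff.1 hl
  cases b <;> simp [channel, bitSignal]

theorem prob_loneTransmissionBefore_succ_le (t : ℕ) :
    prob (A.run model n (t + 1)) (LoneTransmissionBefore d) ≤
      prob (A.run model n t) (LoneTransmissionBefore d) +
        prob ((A.run model n t).bind fun σ => indep n fun i => A.choice (σ i))
          (fun x => t < d ∧ (transmissions x).length = 1) := by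
  classical
  rw [Algorithm.run, prob_bind, prob_bind, prob_eq_expect_ite (A.run model n t), ← expect_add]
  refine expect_mono_support fun σ hσ => ?_
  by_cases h : LoneTransmissionBefore d σ
  · simpa [h] using (prob_le_one _ _).trans le_self_add
  · rw [if_neg h, zero_add, Algorithm.step, prob_map]
    refine prob_mono fun x hx hlone => ?_
    exact (hlone.of_update (onTime_of_mem_support_run hσ) (mem_support_indep hx)).resolve_left h

theorem Predicts.prob_loneTransmissionBefore_le (hP : Predicts A model n d F ε) (t : ℕ) :
    prob (A.run model n t) (LoneTransmissionBefore d) ≤ (min t d : ℕ) * (d * ε) := by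
  induction t with
  | zero => simp [Algorithm.run, prob_pure_of_not not_loneTransmissionBefore_nil]
  | succ t ih =>
    refine (prob_loneTransmissionBefore_succ_le t).trans ?_
    by_cases htd : t < d
    · have lone_le : prob ((A.run model n t).bind fun σ => indep n fun i => A.choice (σ i))
          (fun x => t < d ∧ (transmissions x).length = 1) ≤ d * ε :=
        (prob_mono fun x _ hx => channel_ne_bitSignal hx.2 (F t)).trans
          (hP.prob_runChoices_le htd)
      calc _ ≤ (min t d : ℕ) * (d * ε) + d * ε := add_le_add ih lone_le
        _ = (min (t + 1) d : ℕ) * (d * ε) := by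
          rw [min_eq_left htd.le, min_eq_left (Nat.succ_le_of_lt htd)]; push_cast; ring
    · simpa [htd, prob, min_eq_right (not_lt.1 htd), (not_lt.1 htd).trans t.le_succ] using ih

end Coupling

section DecisionTree

variable {R : Type u} {M : Type v} {Out : Type w}

/-- The state after the choice `ra` of a device in state `h` that receives the signal predicted by
`F`. -/
def soloUpdate (model : CDModel) (F : ℕ → Bool) (h : History R M) (ra : R × Action M) :
    History R M :=
  update model (bitSignal (F h.length)) h (some ra)

/-- The state at time `D` of a device that is in state `h` and receives the signals predicted by
`F` from now on. -/
def Algorithm.soloUntil (A : Algorithm R M Out) (model : CDModel) (F : ℕ → Bool) (D : ℕ)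
    (h : History R M) : PMF (History R M) :=
  A.soloRun model F (D - h.length) h

section SoloUntil

variable {A : Algorithm R M Out} {model : CDModel} {F : ℕ → Bool} {D : ℕ} {h : History R M}

theorem length_soloUpdate (ra : R × Action M) :
    (soloUpdate model F h ra).length = h.length + 1 := by
  simp [soloUpdate, update]

theorem energy_soloUpdate (ra : R × Action M) :
    energy (soloUpdate model F h ra) = energy h + ra.2.cost := by
  simp [soloUpdate, update, energy]

theorem oblivious_soloUpdate_iff {F' F'' : ℕ → Bool} {d : ℕ} {ra : R × Action M} :
    Oblivious F' F'' d (soloUpdate model F h ra) ↔ Oblivious F' F'' d h ∧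
      (ra.2 = .idle ∨ (h.length < d ∧ F' h.length = F'' h.length)) :=
  oblivious_append_singleton_iff

theorem soloUpdate_congr {F' : ℕ → Bool} {ra : R × Action M}
    (hF : ra.2 = .idle ∨ F h.length = F' h.length) :
    soloUpdate model F h ra = soloUpdate model F' h ra := by
  rcases hF with hidle | hF
  · obtain ⟨r, a⟩ := ra
    obtain rfl : a = .idle := hidle
    exact update_idle _ _ _ _ _
  · rw [soloUpdate, hF, soloUpdate]

theorem soloUntil_of_le (hD : D ≤ h.length) : A.soloUntil model F D h = PMF.pure h := by
  rw [Algorithm.soloUntil, Nat.sub_eq_zero_of_le hD, Algorithm.soloRun]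

theorem soloUntil_of_lt (ho : A.output h = none) (hD : h.length < D) :
    A.soloUntil model F D h =
      (A.act h).bind fun ra => A.soloUntil model F D (soloUpdate model F h ra) := by
  obtain ⟨t, ht⟩ := Nat.exists_eq_add_of_lt hD
  have remaining (ra) : D - (soloUpdate model F h ra).length = t := by
    rw [length_soloUpdate]; omega
  simp only [Algorithm.soloUntil, remaining, show D - h.length = t + 1 by omega,
    Algorithm.soloRun, Algorithm.soloStep, Algorithm.choice_of_not_terminal ho, PMF.map_comp,
    PMF.bind_map]
  rfl

theorem energy_le_of_mem_support_soloRun {t : ℕ} {h' : History R M}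
    (hh : h' ∈ (A.soloRun model F t h).support) : energy h ≤ energy h' := by
  induction t generalizing h with
  | zero =>
    obtain rfl : h' = h := by simpa [Algorithm.soloRun] using hh
    exact le_rfl
  | succ t ih =>
    obtain ⟨h₁, hstep, hh⟩ := (PMF.mem_support_bind_iff _ _ _).1 hh
    obtain ⟨_ | ra, -, rfl⟩ := (PMF.mem_support_map_iff _ _ _).1 hstep
    · exact ih hh
    · exact (Nat.le_add_right _ _).trans ((energy_soloUpdate ra).ge.trans (ih hh))

end SoloUntil

variable (A : Algorithm R M Out) (model : CDModel) (d : ℕ → ℕ) (F : ℕ → ℕ → Bool)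

/-- The probability that a device which is in state `h`, and receives the signals predicted for
network `j`, cannot tell at time `d (i + 1)` whether the signals before time `d i` were those
predicted for network `i`. -/
def pairProb (i j : ℕ) (h : History R M) : ℝ≥0∞ :=
  prob (A.soloUntil model (F j) (d (i + 1)) h) (Oblivious (F i) (F j) (d i))

/-- The probability that a device which is in state `h`, and receives the signals predicted for
network `i`, has spent at least `x` units of energy at time `d i`. -/
def costProb (i x : ℕ) (h : History R M) : ℝ≥0∞ :=
  prob (A.soloUntil model (F i) (d i) h) (fun h' => x ≤ energy h')

/-- The sum of the probabilities of confusing two networks in `S` and of spending `x` units of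
energy in a network in `S`, as seen from state `h`. -/
def potential (S : Finset ℕ) (x : ℕ) (h : History R M) : ℝ≥0∞ :=
  ∑ ij ∈ S ×ˢ S with ij.1 < ij.2, pairProb A model d F ij.1 ij.2 h +
    ∑ i ∈ S, costProb A model d F i x h

/-- The potential after the choice `ra` in state `h`, without the cost in networks whose time is
up. -/
def stepPotential (S : Finset ℕ) (x : ℕ) (h : History R M) (ra : R × Action M) : ℝ≥0∞ :=
  ∑ ij ∈ S ×ˢ S with ij.1 < ij.2, pairProb A model d F ij.1 ij.2 (soloUpdate model (F ij.2) h ra) +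
    ∑ i ∈ S with h.length < d i, costProb A model d F i x (soloUpdate model (F i) h ra)

variable {A model d F} {S : Finset ℕ} {x : ℕ} {h : History R M}

theorem one_le_potential_of_nonempty (hS : S.Nonempty) :
    1 ≤ potential A model d F S (energy h) h := by
  obtain ⟨i, hi⟩ := hS
  have cost_eq : costProb A model d F i (energy h) h = 1 :=
    prob_eq_one fun h' hh' => energy_le_of_mem_support_soloRun hh'
  exact cost_eq.ge.trans ((Finset.single_le_sum (f := fun i => costProb A model d F i _ h)
    (fun _ _ => zero_le) hi).trans le_add_self)

theorem one_le_potential_of_resolved {i j : ℕ} (hi : i ∈ S) (hj : j ∈ S) (hij : i < j)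
    (hobl : Oblivious (F i) (F j) (d i) h) (hres : A.output h ≠ none ∨ d (i + 1) ≤ h.length) :
    1 ≤ potential A model d F S x h := by
  have run_eq : A.soloUntil model (F j) (d (i + 1)) h = PMF.pure h :=
    hres.elim (fun ho => soloRun_of_terminal ho _) soloUntil_of_le
  have pair_eq : pairProb A model d F i j h = 1 := by
    rw [pairProb, run_eq]
    exact prob_eq_one fun h' hh' => by rwa [(PMF.mem_support_pure_iff _ _).1 hh']
  have hmem : (i, j) ∈ (S ×ˢ S).filter fun ij => ij.1 < ij.2 := by simp [hi, hj, hij]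
  exact pair_eq.ge.trans ((Finset.single_le_sum
    (f := fun ij : ℕ × ℕ => pairProb A model d F ij.1 ij.2 h) (fun _ _ => zero_le) hmem).trans
      le_self_add)

theorem expect_stepPotential_le_potential (ho : A.output h = none)
    (hlen : ∀ i ∈ S, ∀ j ∈ S, i < j → h.length < d (i + 1)) :
    expect (A.act h) (stepPotential A model d F S x h) ≤ potential A model d F S x h := by
  unfold stepPotential
  rw [expect_add, expect_sum, expect_sum]
  refine add_le_add (le_of_eq (Finset.sum_congr rfl fun ij hij => ?_))
    (le_trans (le_of_eq (Finset.sum_congr rfl fun i hi => ?_))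
      (Finset.sum_le_sum_of_subset (Finset.filter_subset _ S)))
  · simp only [Finset.mem_filter, Finset.mem_product] at hij
    simp only [pairProb]
    rw [soloUntil_of_lt ho (hlen _ hij.1.1 _ hij.1.2 hij.2), prob_bind]
  · simp only [costProb]
    rw [soloUntil_of_lt ho (Finset.mem_filter.1 hi).2, prob_bind]

theorem potential_le_stepPotential_of_idle {ra : R × Action M} (hra : ra.2 = .idle)
    (hx : energy h < x) (k : ℕ) :
    potential A model d F S x (soloUpdate model (F k) h ra) ≤
      stepPotential A model d F S x h ra := by
  have congr_soloUpdate (i) : soloUpdate model (F i) h ra = soloUpdate model (F k) h ra :=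
    soloUpdate_congr (.inl hra)
  simp only [potential, stepPotential, congr_soloUpdate]
  refine add_le_add le_rfl (le_of_eq ?_)
  rw [Finset.sum_filter]
  refine Finset.sum_congr rfl fun i _ => ?_
  split_ifs with hi
  · rfl
  · rw [costProb, soloUntil_of_le (by rw [length_soloUpdate]; omega), prob_pure_of_not]
    simpa [energy_soloUpdate, hra, Action.cost] using hx

theorem potential_le_stepPotential_of_subset {S' : Finset ℕ} (hS' : S' ⊆ S)
    (hlen : ∀ i ∈ S', h.length < d i) {k : ℕ} (hbit : ∀ i ∈ S', F i h.length = F k h.length)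
    (ra : R × Action M) :
    potential A model d F S' x (soloUpdate model (F k) h ra) ≤
      stepPotential A model d F S x h ra := by
  have congr_soloUpdate {i} (hi : i ∈ S') :
      soloUpdate model (F k) h ra = soloUpdate model (F i) h ra :=
    soloUpdate_congr (.inr (hbit i hi).symm)
  refine add_le_add (le_trans (le_of_eq (Finset.sum_congr rfl fun ij hij => ?_))
      (Finset.sum_le_sum_of_subset (Finset.filter_subset_filter _
        (Finset.product_subset_product hS' hS'))))
    (le_trans (le_of_eq (Finset.sum_congr rfl fun i hi => ?_)) (Finset.sum_le_sum_of_subset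
      fun i hi => Finset.mem_filter.2 ⟨hS' hi, hlen i hi⟩))
  · simp only [Finset.mem_filter, Finset.mem_product] at hij
    rw [congr_soloUpdate hij.1.2]
  · rw [congr_soloUpdate hi]

theorem exists_two_pow_le_card_filter (hd : Monotone d) {t e : ℕ} (hS : 2 ^ (e + 1) ≤ S.card)
    (hlen : ∀ i ∈ S, ∀ j ∈ S, i < j → t < d (i + 1)) :
    ∃ k, 2 ^ e ≤ (S.filter fun i => t < d i ∧ F i t = F k t).card := by
  have stale_unique : (S.filter fun i => ¬ t < d i).card ≤ 1 := by
    refine Finset.card_le_one.2 fun i hi j hj => by_contra fun hne => ?_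
    rw [Finset.mem_filter] at hi hj
    rcases lt_or_gt_of_ne hne with hij | hji
    · exact hj.2 ((hlen i hi.1 j hj.1 hij).trans_le (hd hij))
    · exact hi.2 ((hlen j hj.1 i hi.1 hji).trans_le (hd hji))
  have card_live := Finset.card_filter_add_card_filter_not (s := S) (fun i => t < d i)
  obtain ⟨b, hb⟩ : ∃ b, 2 ^ e ≤ (S.filter fun i => t < d i ∧ F i t = b).card := by
    have card_bits := Finset.card_filter_add_card_filter_not
      (s := S.filter fun i => t < d i) (fun i => F i t = true)
    simp only [Finset.filter_filter, Bool.not_eq_true] at card_bits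
    rw [pow_succ] at hS
    by_contra! hlt
    have := hlt true
    have := hlt false
    omega
  obtain ⟨k, hk⟩ := Finset.card_pos.1 ((Nat.two_pow_pos e).trans_le hb)
  exact ⟨k, by rwa [(Finset.mem_filter.1 hk).2.2]⟩

theorem cost_of_ne_idle {a : Action M} (ha : a ≠ .idle) : a.cost = 1 := by
  cases a <;> simp_all [Action.cost]

theorem exists_potential_le_stepPotential (hd : Monotone d) {e : ℕ} (hS : 2 ^ (e + 1) ≤ S.card)
    (hlen : ∀ i ∈ S, ∀ j ∈ S, i < j → h.length < d (i + 1))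
    (hobl : ∀ i ∈ S, ∀ j ∈ S, i < j → Oblivious (F i) (F j) (d i) h) (ra : R × Action M) :
    ∃ k, ∃ S' ⊆ S, ∃ e', 2 ^ e' ≤ S'.card ∧ ra.2.cost + e' = e + 1 ∧
      (∀ i ∈ S', ∀ j ∈ S', i < j →
        Oblivious (F i) (F j) (d i) (soloUpdate model (F k) h ra)) ∧
      potential A model d F S' (energy h + (e + 1)) (soloUpdate model (F k) h ra) ≤
        stepPotential A model d F S (energy h + (e + 1)) h ra := by
  by_cases hra : ra.2 = .idle
  · refine ⟨0, S, subset_rfl, e + 1, hS, by simp [hra, Action.cost], fun i hi j hj hij => ?_,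
      potential_le_stepPotential_of_idle hra (by omega) 0⟩
    exact oblivious_soloUpdate_iff.2 ⟨hobl i hi j hj hij, .inl hra⟩
  · obtain ⟨k, hk⟩ := exists_two_pow_le_card_filter hd hS hlen
    set S' := S.filter fun i => h.length < d i ∧ F i h.length = F k h.length
    have hS' : S' ⊆ S := Finset.filter_subset _ _
    have mem_S' {i} (hi : i ∈ S') := (Finset.mem_filter.1 hi).2
    refine ⟨k, S', hS', e, hk, by rw [cost_of_ne_idle hra, add_comm], fun i hi j hj hij => ?_,
      potential_le_stepPotential_of_subset hS' (fun i hi => (mem_S' hi).1)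
        (fun i hi => (mem_S' hi).2) ra⟩
    exact oblivious_soloUpdate_iff.2 ⟨hobl i (hS' hi) j (hS' hj) hij,
      .inr ⟨(mem_S' hi).1, (mem_S' hi).2.trans (mem_S' hj).2.symm⟩⟩

/-- Each unit of energy reveals one bit of the predicted signals, hence leaves at least half of
the networks indistinguishable. -/
theorem one_le_potential (hd : Monotone d) (N : ℕ) {e : ℕ} (hN : ∀ i ∈ S, d i ≤ h.length + N)
    (hS : 2 ^ e ≤ S.card) (hobl : ∀ i ∈ S, ∀ j ∈ S, i < j → Oblivious (F i) (F j) (d i) h) :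
    1 ≤ potential A model d F S (energy h + e) h := by
  induction N generalizing h S e with
  | zero =>
    rcases e with _ | e
    · exact one_le_potential_of_nonempty (Finset.card_pos.1 (by simpa using hS))
    · obtain ⟨i, hi, j, hj, hij⟩ := (Finset.one_lt_card_iff_nontrivial.1
        ((Nat.one_lt_two_pow e.succ_ne_zero).trans_le hS)).exists_lt
      exact one_le_potential_of_resolved hi hj hij (hobl i hi j hj hij)
        (.inr ((hd hij).trans (hN j hj)))
  | succ N ih =>
    rcases e with _ | e
    · exact one_le_potential_of_nonempty (Finset.card_pos.1 (by simpa using hS))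
    by_cases hres : ∃ i ∈ S, ∃ j ∈ S, i < j ∧ (A.output h ≠ none ∨ d (i + 1) ≤ h.length)
    · obtain ⟨i, hi, j, hj, hij, hres⟩ := hres
      exact one_le_potential_of_resolved hi hj hij (hobl i hi j hj hij) hres
    push Not at hres
    have hlen (i) (hi : i ∈ S) (j) (hj : j ∈ S) (hij : i < j) := (hres i hi j hj hij).2
    obtain ⟨i, hi, j, hj, hij⟩ := (Finset.one_lt_card_iff_nontrivial.1
      ((Nat.one_lt_two_pow e.succ_ne_zero).trans_le hS)).exists_lt
    refine le_trans (one_le_expect fun ra _ => ?_)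
      (expect_stepPotential_le_potential (hres i hi j hj hij).1 hlen)
    obtain ⟨k, S', hS', e', hcard, hcost, hobl', hle⟩ :=
      exists_potential_le_stepPotential hd hS hlen hobl ra
    refine le_trans ?_ hle
    rw [← hcost, ← add_assoc, ← energy_soloUpdate]
    exact ih (fun i hi => by rw [length_soloUpdate, add_assoc, add_comm 1]; exact hN i (hS' hi))
      hcard hobl'

end DecisionTree

section PredictableNetwork

theorem exists_threshold_signals {α : Type*} [LinearOrder α] {f : (ℕ → Bool) → ℕ → α}
    (hf : ∀ F F' t, (∀ i < t, F i = F' i) → f F t = f F' t) (θ : α) (d : ℕ) :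
    ∃ F : ℕ → Bool, ∀ t < d, (F t = true ↔ θ ≤ f F t) := by
  induction d with
  | zero => exact ⟨fun _ => false, by simp⟩
  | succ d ih =>
    obtain ⟨F, hF⟩ := ih
    refine ⟨Function.update F d (decide (θ ≤ f F d)), fun t ht => ?_⟩
    rw [hf _ F t fun i hi => Function.update_of_ne (by omega) _ _]
    rcases Nat.lt_succ_iff_lt_or_eq.1 ht with h | rfl
    · rw [Function.update_of_ne h.ne]
      exact hF t h
    · simp

theorem exists_finset_forall_mem {α : Type*} {f : (ℕ → Bool) → ℕ → α}
    (hf : ∀ F F' t, (∀ i < t, F i = F' i) → f F t = f F' t) (d : ℕ) :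
    ∃ V : Finset α, V.card ≤ d * 2 ^ d ∧ ∀ F, ∀ t < d, f F t ∈ V := by
  classical
  let value (q : Fin d × (Fin d → Bool)) : α :=
    f (fun i => if h : i < d then q.2 ⟨i, h⟩ else false) q.1
  refine ⟨Finset.univ.image value, Finset.card_image_le.trans (by simp), fun F t ht => ?_⟩
  refine Finset.mem_image.2 ⟨(⟨t, ht⟩, fun i => F i), Finset.mem_univ _, hf _ _ _ fun i hi => ?_⟩
  simp [hi.trans ht]

theorem exists_gap_of_antitone {α : Type*} [LinearOrder α] {a : ℕ → α} (ha : Antitone a)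
    (V : Finset α) : ∃ y ≤ V.card, ∀ v ∈ V, v ≤ a (y + 1) ∨ a y ≤ v := by
  by_contra! no_gap
  have : Nonempty α := ⟨(no_gap 0 (Nat.zero_le _)).choose⟩
  choose! v hv using no_gap
  obtain ⟨y, hy, y', hy', hne, heq⟩ := Finset.exists_ne_map_eq_of_card_lt_of_maps_to
    (s := Finset.range (V.card + 1)) (t := V) (f := v) (by simp)
    fun y hy => (hv y (Finset.mem_range_succ_iff.1 hy)).1
  rw [Finset.mem_range_succ_iff] at hy hy'
  wlog hlt : y < y' generalizing y y'
  · exact this y' hy' y hy hne.symm heq.symm (by omega)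
  · exact lt_irrefl (v y) (calc
      v y = v y' := heq
      _ < a y' := (hv y' hy').2.2
      _ ≤ a (y + 1) := ha hlt
      _ < v y := (hv y hy).2.1)

theorem pow_mul_two_pow_le_one {p q : ℝ≥0∞} (hpq : p + q = 1) {r : ℕ} (hr : r ≠ 0)
    (hp : (r : ℝ≥0∞)⁻¹ ≤ p) (m : ℕ) : q ^ (r * m) * 2 ^ m ≤ 1 := by
  have q_le_one : q ≤ 1 := hpq ▸ le_add_self
  have mul_le_one : q * (1 + (r : ℝ≥0∞)⁻¹) ≤ 1 := by
    calc q * (1 + (r : ℝ≥0∞)⁻¹) = q * (r : ℝ≥0∞)⁻¹ + q := by ring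
      _ ≤ 1 * p + q := by gcongr
      _ = 1 := by rw [one_mul, hpq]
  have two_le : (2 : ℝ≥0∞) ≤ (1 + (r : ℝ≥0∞)⁻¹) ^ r := by
    calc (2 : ℝ≥0∞) = 1 + r * (r : ℝ≥0∞)⁻¹ := by
          rw [ENNReal.mul_inv_cancel (by simpa using hr) (by simp), one_add_one_eq_two]
      _ ≤ (1 + (r : ℝ≥0∞)⁻¹) ^ r := one_add_mul_le_pow_of_sq_nonneg zero_le zero_le zero_le r
  calc q ^ (r * m) * 2 ^ m ≤ q ^ (r * m) * ((1 + (r : ℝ≥0∞)⁻¹) ^ r) ^ m := by gcongr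
    _ = (q * (1 + (r : ℝ≥0∞)⁻¹)) ^ (r * m) := by rw [mul_pow, pow_mul (1 + _)]
    _ ≤ 1 := pow_le_one₀ zero_le mul_le_one

theorem natCast_mul_inv_le {a b n : ℕ} (h : a * b ≤ n) :
    (a : ℝ≥0∞) * (n : ℝ≥0∞)⁻¹ ≤ (b : ℝ≥0∞)⁻¹ := by
  rw [ENNReal.le_inv_iff_mul_le]
  calc (a : ℝ≥0∞) * (n : ℝ≥0∞)⁻¹ * b = (a * b : ℕ) * (n : ℝ≥0∞)⁻¹ := by push_cast; ring
    _ ≤ n * (n : ℝ≥0∞)⁻¹ := by gcongr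
    _ ≤ 1 := ENNReal.mul_inv_le_one _

theorem mul_sq_le_two_pow {N : ℕ} (hN : 16 ≤ N) : 32 * N ^ 2 ≤ 2 ^ N := by
  induction N, hN using Nat.le_induction with
  | base => norm_num
  | succ N hN ih => rw [pow_succ 2]; nlinarith

theorem two_pow_add_mul_two_pow_lt {d : ℕ} (hd : 3 ≤ d) :
    2 ^ d + 5 * (d * 2 ^ d) < 2 ^ 2 ^ d := by
  induction d, hd using Nat.le_induction with
  | base => norm_num
  | succ d hd ih =>
    have eight_le : 2 ^ 3 ≤ 2 ^ d := Nat.pow_le_pow_right (by norm_num) hd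
    have eight_le' : 2 ^ 3 ≤ 2 ^ 2 ^ d := Nat.pow_le_pow_right (by norm_num) (by omega)
    rw [pow_succ 2 d, pow_mul, sq]
    nlinarith

variable {R : Type u} {M : Type v} {Out : Type w}

theorem prob_channel_ne_silence_le {n : ℕ} (p : PMF (Option (R × Action M))) (hn : n ≠ 0)
    (hp : prob p Sends ≤ ((n : ℝ≥0∞) ^ 16)⁻¹) :
    prob (indep n fun _ => p) (fun x => channel (transmissions x) ≠ .silence) ≤
      ((n : ℝ≥0∞) ^ 10)⁻¹ := by
  simp only [ne_eq, channel_eq_silence_iff]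
  calc prob (indep n fun _ => p) (fun x => transmissions x ≠ []) ≤ n * prob p Sends :=
        prob_transmissions_ne_nil_le p
    _ ≤ n * ((n ^ 16 : ℕ) : ℝ≥0∞)⁻¹ := by push_cast; gcongr
    _ ≤ ((n ^ 10 : ℕ) : ℝ≥0∞)⁻¹ := natCast_mul_inv_le <| by
        rw [← pow_succ']; exact Nat.pow_le_pow_right (Nat.pos_of_ne_zero hn) (by norm_num)
    _ = ((n : ℝ≥0∞) ^ 10)⁻¹ := by push_cast; rfl

theorem prob_channel_ne_noise_le {z : ℕ} (p : PMF (Option (R × Action M))) (hz : 16 ≤ z)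
    (hp : (2 ^ z : ℝ≥0∞)⁻¹ ≤ prob p Sends) :
    prob (indep (2 ^ (2 * z)) fun _ => p) (fun x => channel (transmissions x) ≠ .noise) ≤
      (((2 ^ (2 * z) : ℕ) : ℝ≥0∞) ^ 10)⁻¹ := by
  simp only [ne_eq, channel_eq_noise_iff, not_not]
  obtain ⟨m, hm⟩ : ∃ m, 2 ^ (2 * z) = m + 1 := Nat.exists_eq_add_one.2 (by positivity)
  set r := 2 ^ z with hr
  have r_mul_le : r * (r - 1) ≤ m := by
    have : r * r = m + 1 := by rw [hr, ← pow_add, ← two_mul, hm]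
    rw [Nat.mul_sub, this]
    have : 1 ≤ r := Nat.one_le_two_pow
    omega
  have pow_le : (m + 1) ^ 11 ≤ 2 ^ (r - 1) := by
    rw [← hm, ← pow_mul]
    refine Nat.pow_le_pow_right (by norm_num) ?_
    have := mul_sq_le_two_pow hz
    have : z * 16 ≤ z ^ 2 := by nlinarith
    omega
  set q := prob p fun c => ¬ Sends c
  have sum_eq_one : prob p Sends + q = 1 := prob_add_prob_not _ _
  rw [hm]
  refine (prob_length_transmissions_le_one p m).trans (ENNReal.le_inv_iff_mul_le.2 ?_)
  calc ((m : ℝ≥0∞) + 1) * q ^ m * ((m + 1 : ℕ) : ℝ≥0∞) ^ 10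
      = q ^ m * (((m + 1) ^ 11 : ℕ) : ℝ≥0∞) := by push_cast; ring
    _ ≤ q ^ (r * (r - 1)) * ((2 ^ (r - 1) : ℕ) : ℝ≥0∞) :=
        mul_le_mul' (pow_le_pow_of_le_one zero_le (prob_le_one _ _) r_mul_le)
          (by exact_mod_cast pow_le)
    _ ≤ 1 := by
        push_cast
        exact pow_mul_two_pow_le_one sum_eq_one (by positivity) (by simpa [hr] using hp) _

variable (A : Algorithm R M Out) (model : CDModel)

/-- In a network of size `n` the signals before time `d` are predicted by `F`, where `n` is much
larger than `d`. -/
structure PredictableNetwork (d n : ℕ) (F : ℕ → Bool) : Prop where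
  predicts : Predicts A model n d F ((n : ℝ≥0∞) ^ 10)⁻¹
  exists_eq : ∃ x, 2 ^ d ≤ x ∧ n = 2 ^ 2 ^ x
  le : n ≤ 2 ^ 2 ^ 2 ^ 2 ^ d

/-- Only `d * 2 ^ d` values occur as the probability that a device transmits in a slot before `d`,
so the size `n` can be chosen such that none of them lies between `n ^ (-16)`, where silence is
almost certain, and `n ^ (-1 / 2)`, where noise is almost certain. -/
theorem exists_predictableNetwork {d : ℕ} (hd : 3 ≤ d) :
    ∃ n F, PredictableNetwork A model d n F := by
  let sendProb (F : ℕ → Bool) (t : ℕ) : ℝ≥0∞ := prob (A.soloChoice model F t) Sends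
  have sendProb_congr (F F' : ℕ → Bool) (t : ℕ) (h : ∀ i < t, F i = F' i) :
      sendProb F t = sendProb F' t := congrArg (prob · Sends) (soloChoice_congr h)
  have antitone_threshold : Antitone fun y => (2 ^ 2 ^ (2 ^ d + 5 * y) : ℝ≥0∞)⁻¹ := fun y y' h =>
    ENNReal.inv_le_inv.2 (pow_le_pow_right₀ one_le_two (pow_le_pow_right₀ one_le_two (by omega)))
  obtain ⟨V, hV, mem_V⟩ := exists_finset_forall_mem sendProb_congr d
  obtain ⟨y, hy, hgap⟩ := exists_gap_of_antitone antitone_threshold V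
  obtain ⟨F, hF⟩ := exists_threshold_signals sendProb_congr (2 ^ 2 ^ (2 ^ d + 5 * y))⁻¹ d
  set w := 2 ^ d + 5 * y
  refine ⟨2 ^ 2 ^ (w + 1), F, fun t ht => ?_, ⟨w + 1, by omega, rfl⟩, ?_⟩
  · cases hFt : F t
    · have not_high : ¬ (2 ^ 2 ^ w)⁻¹ ≤ sendProb F t := by simp [← hF t ht, hFt]
      refine prob_channel_ne_silence_le _ (by positivity)
        (((hgap _ (mem_V F t ht)).resolve_right not_high).trans (le_of_eq ?_))
      push_cast
      rw [← pow_mul, show 2 ^ d + 5 * (y + 1) = w + 1 + 4 by omega, pow_add 2 (w + 1) 4]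
      norm_num
    · rw [pow_succ' 2 w]
      refine prob_channel_ne_noise_le _ ?_ ((hF t ht).1 hFt)
      have : 2 ^ 3 ≤ 2 ^ d := Nat.pow_le_pow_right (by norm_num) hd
      calc 16 ≤ 2 ^ 8 := by norm_num
        _ ≤ 2 ^ w := Nat.pow_le_pow_right (by norm_num) (by omega)
  · have := two_pow_add_mul_two_pow_lt hd
    exact Nat.pow_le_pow_right (by norm_num) (Nat.pow_le_pow_right (by norm_num) (by omega))

variable {A model} {d n : ℕ} {F : ℕ → Bool}

theorem PredictableNetwork.exists_two_pow (hN : PredictableNetwork A model d n F) (hd : 3 ≤ d) :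
    ∃ N, n = 2 ^ N ∧ 16 ≤ N ∧ d ≤ N := by
  obtain ⟨x, hx, rfl⟩ := hN.exists_eq
  have eight_le : 2 ^ 3 ≤ 2 ^ d := Nat.pow_le_pow_right (by norm_num) hd
  have two_pow_le : 2 ^ 2 ^ 3 ≤ 2 ^ x := Nat.pow_le_pow_right (by norm_num) (eight_le.trans hx)
  have : d < 2 ^ d := Nat.lt_two_pow_self
  have : x < 2 ^ x := Nat.lt_two_pow_self
  exact ⟨2 ^ x, rfl, by omega, by omega⟩

theorem PredictableNetwork.mul_sq_le (hN : PredictableNetwork A model d n F) (hd : 3 ≤ d) :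
    32 * d ^ 2 ≤ n := by
  obtain ⟨N, rfl, hN16, hdN⟩ := hN.exists_two_pow hd
  exact le_trans (by gcongr) (mul_sq_le_two_pow hN16)

theorem PredictableNetwork.mul_mul_error_le (hN : PredictableNetwork A model d n F)
    (hd : 3 ≤ d) : (d : ℝ≥0∞) * (d * ((n : ℝ≥0∞) ^ 10)⁻¹) ≤ ((n : ℝ≥0∞) ^ 8)⁻¹ := by
  have := hN.mul_sq_le hd
  have sq_mul_le : d * d * n ^ 8 ≤ n ^ 10 := by
    calc d * d * n ^ 8 ≤ n ^ 2 * n ^ 8 := by gcongr; nlinarith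
      _ = n ^ 10 := by ring
  simpa [mul_assoc] using natCast_mul_inv_le sq_mul_le

theorem PredictableNetwork.mul_error_le (hN : PredictableNetwork A model d n F) (hd : 3 ≤ d) :
    (d : ℝ≥0∞) * ((n : ℝ≥0∞) ^ 10)⁻¹ ≤ ((n : ℝ≥0∞) ^ 8)⁻¹ :=
  (le_mul_of_one_le_left zero_le (by exact_mod_cast (by omega : 1 ≤ d))).trans
    (hN.mul_mul_error_le hd)

theorem PredictableNetwork.pow_le_inv (hN : PredictableNetwork A model d n F) (hd : 3 ≤ d)
    {K : ℕ} (hK0 : K ≠ 0) (hK : K ≤ d) {p q : ℝ≥0∞} (hpq : p + q = 1)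
    (hp : ((4 * K : ℕ) : ℝ≥0∞)⁻¹ ≤ p) : q ^ n ≤ ((n : ℝ≥0∞) ^ 8)⁻¹ := by
  obtain ⟨N, rfl, hN16, hdN⟩ := hN.exists_two_pow hd
  have exponent_le : 4 * K * (8 * N) ≤ 2 ^ N :=
    calc 4 * K * (8 * N) ≤ 4 * N * (8 * N) := by gcongr; exact hK.trans hdN
      _ = 32 * N ^ 2 := by ring
      _ ≤ 2 ^ N := mul_sq_le_two_pow hN16
  rw [ENNReal.le_inv_iff_mul_le]
  calc q ^ 2 ^ N * ((2 ^ N : ℕ) : ℝ≥0∞) ^ 8 ≤ q ^ (4 * K * (8 * N)) * 2 ^ (8 * N) := by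
        refine mul_le_mul' (pow_le_pow_of_le_one zero_le (hpq ▸ le_add_self) exponent_le) ?_
        push_cast
        rw [← pow_mul, mul_comm N 8]
    _ ≤ 1 := pow_mul_two_pow_le_one hpq (by omega) hp _

theorem PredictableNetwork.one_sub_le_prob_exists (hN : PredictableNetwork A model d n F)
    (hd : 3 ≤ d) {K : ℕ} (hK0 : K ≠ 0) (hK : K ≤ d) {Q : History R M → Prop}
    (hQ : ((4 * K : ℕ) : ℝ≥0∞)⁻¹ ≤ prob (A.soloRun model F d []) Q) :
    1 - ((n : ℝ≥0∞) ^ 7)⁻¹ ≤ prob (A.run model n d) (fun σ => ∃ s, Q (σ s)) := by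
  have two_mul_le : 2 * n ^ 7 ≤ n ^ 8 := by
    have := hN.mul_sq_le hd
    rw [pow_succ' n 7]
    gcongr
    nlinarith
  have prob_forall_not_le :
      prob (A.run model n d) (fun σ => ¬ ∃ s, Q (σ s)) ≤ ((n : ℝ≥0∞) ^ 7)⁻¹ := by
    classical
    calc prob (A.run model n d) (fun σ => ¬ ∃ s, Q (σ s))
        ≤ prob (indep n fun _ => A.soloRun model F d []) (fun σ => ¬ ∃ s, Q (σ s)) +
          d * ((n : ℝ≥0∞) ^ 10)⁻¹ := by
          simp only [prob_eq_expect_ite]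
          exact hN.predicts.expect_run_le le_rfl fun σ => by split_ifs <;> simp
      _ = prob (A.soloRun model F d []) (fun h => ¬ Q h) ^ n + d * ((n : ℝ≥0∞) ^ 10)⁻¹ := by
          rw [← prob_indep_forall]
          simp only [not_exists]
      _ ≤ ((n : ℝ≥0∞) ^ 8)⁻¹ + ((n : ℝ≥0∞) ^ 8)⁻¹ :=
          add_le_add (hN.pow_le_inv hd hK0 hK (prob_add_prob_not _ _) hQ) (hN.mul_error_le hd)
      _ ≤ ((n : ℝ≥0∞) ^ 7)⁻¹ := by
          rw [← two_mul]
          exact_mod_cast natCast_mul_inv_le two_mul_le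
  rw [tsub_le_iff_right]
  exact (prob_add_prob_not _ _).ge.trans (add_le_add_right prob_forall_not_le _)

end PredictableNetwork

section SizeSensitive

variable {R : Type u} {M : Type v} {Out : Type w}

/-- What the lower bound needs to know about a problem, with the factor `b` saying how far apart
two network sizes have to be: all devices terminate, and a device that ends in the same state in
networks of sizes more than a factor `b` apart, without having noticed when the network became
unpredictable, owes its success in the smaller network to an early lone transmission. -/
structure Criterion.SizeSensitive (P : Criterion R M Out) (b : ℝ) : Prop where
  terminates {A : Algorithm R M Out} {n : ℕ} {σ : Fin n → History R M} :
    P A n σ → ∀ s, A.output (σ s) ≠ none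
  loneTransmissionBefore {A : Algorithm R M Out} {n n' : ℕ} {σ : Fin n → History R M}
    {σ' : Fin n' → History R M} {s : Fin n} {s' : Fin n'} {F F' : ℕ → Bool} {d : ℕ} :
    b * n < n' → P A n σ → P A n' σ' → σ s = σ' s' → Oblivious F F' d (σ s) →
      LoneTransmissionBefore d σ

theorem sizeSensitive_approximateCounting {c : ℝ} (hc : 1 ≤ c) :
    (ApproximateCounting c : Criterion R M ℝ).SizeSensitive (c ^ 2) where
  terminates := fun ⟨_, _, _, hout⟩ s => by simp [hout s]
  loneTransmissionBefore := by
    rintro A n n' σ σ' s s' F F' d hgap ⟨est, -, hle, hout⟩ ⟨est', hge', -, hout'⟩ hs -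
    exfalso
    obtain rfl : est = est' := Option.some_injective _ (by rw [← hout s, ← hout' s', hs])
    rw [div_le_iff₀ (by linarith)] at hge'
    nlinarith

theorem Oblivious.lt_of_transmitsAt {F F' : ℕ → Bool} {d t : ℕ} {h : History R M}
    (hobl : Oblivious F F' d h) (ht : TransmitsAt h t) : t < d := by
  obtain ⟨e, he, m, hm⟩ := ht
  exact ((hobl t e he).resolve_left (by simp [hm])).1

theorem Oblivious.lt_of_listensAt {F F' : ℕ → Bool} {d t : ℕ} {h : History R M}
    (hobl : Oblivious F F' d h) (ht : ListensAt h t) : t < d := by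
  obtain ⟨e, he, hlisten⟩ := ht
  exact ((hobl t e he).resolve_left (by simp [hlisten])).1

theorem ListensAt.not_transmitsAt {h : History R M} {t : ℕ} (ht : ListensAt h t) :
    ¬ TransmitsAt h t := by
  obtain ⟨e, he, hlisten⟩ := ht
  rintro ⟨e', he', m, hm⟩
  obtain rfl : e = e' := by simpa [he] using he'
  simp [hlisten] at hm

theorem sizeSensitive_leaderElection :
    (LeaderElection : Criterion R M Role).SizeSensitive 0 where
  terminates := fun ⟨l, hl, hfollower, _⟩ s => by
    by_cases hs : s = l
    · simp [hs, hl]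
    · simp [hfollower s hs]
  loneTransmissionBefore := by
    rintro A n n' σ σ' s s' F F' d - ⟨l, -, -, t, -, hleader, hlisten⟩ - - hobl
    refine ⟨t, ?_, l, hleader, fun s' hs' => (hlisten s' hs').not_transmitsAt⟩
    by_cases hs : s = l
    · exact hobl.lt_of_transmitsAt (hs ▸ hleader)
    · exact hobl.lt_of_listensAt (hlisten s hs)

theorem sizeSensitive_contentionResolution :
    (ContentionResolution : Criterion R M Out).SizeSensitive 0 where
  terminates := fun h s => Option.isSome_iff_ne_none.1 (h s).1
  loneTransmissionBefore := by
    intro A n n' σ σ' s s' F F' d _ h _ _ hobl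
    obtain ⟨-, t, htransmit, hlone⟩ := h s
    exact ⟨t, hobl.lt_of_transmitsAt htransmit, s, htransmit, hlone⟩

variable {P : Criterion R M Out} {b : ℝ} {A : Algorithm R M Out} {model : CDModel}
  {T T' : ℕ → ℕ}

theorem Algorithm.Solves.prob_not_le (hA : A.Solves model P T)
    (hP : ∀ {n σ}, P A n σ → ∀ s, A.output (σ s) ≠ none) {n t : ℕ} (hn : 1 ≤ n) (ht : T n ≤ t) :
    prob (A.run model n t) (fun σ => ¬ P A n σ) ≤ (n : ℝ≥0∞)⁻¹ := by
  have closed (σ) (hσ : P A n σ) (σ') (hσ' : σ' ∈ (A.step model σ).support) : P A n σ' := by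
    obtain rfl : σ' = σ := funext fun i => eq_of_mem_support_step_of_terminal hσ' (hP hσ i)
    exact hσ
  refine le_trans ?_ (hA n hn)
  rw [← ENNReal.add_le_add_iff_left
    ((prob_le_one (A.run model n t) (P A n)).trans_lt ENNReal.one_lt_top).ne, prob_add_prob_not]
  calc 1 = prob (A.run model n (T n)) (P A n) + prob (A.run model n (T n)) (fun σ => ¬ P A n σ) :=
        (prob_add_prob_not _ _).symm
    _ ≤ _ := add_le_add_left (monotone_prob_run closed ht) _

theorem Algorithm.Solves.mono (hA : A.Solves model P T)
    (hP : ∀ {n σ}, P A n σ → ∀ s, A.output (σ s) ≠ none) (hT : ∀ n, 1 ≤ n → T n ≤ T' n) :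
    A.Solves model P T' :=
  fun n hn => hA.prob_not_le hP hn (hT n hn)

end SizeSensitive

section Chain

variable {R : Type u} {M : Type v} {Out : Type w}

/-- Predictable networks such that network `i` is predictable before time `D i`, and every
execution in it is over, up to failures, by time `D (i + 1)`. -/
structure NetworkChain (A : Algorithm R M Out) (model : CDModel) (T D n : ℕ → ℕ)
    (F : ℕ → ℕ → Bool) : Prop where
  monotone : Monotone D
  three_le (i : ℕ) : 3 ≤ D i
  network (i : ℕ) : PredictableNetwork A model (D i) (n i) (F i)
  size_le (i : ℕ) : n i ≤ D (i + 1)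
  time_le (i : ℕ) : T (n i) ≤ D (i + 1)

variable {A : Algorithm R M Out} {model : CDModel} {T D n : ℕ → ℕ} {F : ℕ → ℕ → Bool}

theorem NetworkChain.mul_sq_le (hC : NetworkChain A model T D n F) (i : ℕ) :
    32 * D i ^ 2 ≤ n i :=
  (hC.network i).mul_sq_le (hC.three_le i)

theorem NetworkChain.le_size (hC : NetworkChain A model T D n F) (i : ℕ) : D i ≤ n i := by
  nlinarith [hC.mul_sq_le i]

theorem NetworkChain.size_pos (hC : NetworkChain A model T D n F) (i : ℕ) : 0 < n i :=
  (zero_lt_three.trans_le (hC.three_le i)).trans_le (hC.le_size i)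

theorem NetworkChain.size_le_size (hC : NetworkChain A model T D n F) {i j : ℕ} (hij : i < j) :
    n i ≤ n j :=
  (hC.size_le i).trans ((hC.monotone hij).trans (hC.le_size j))

theorem NetworkChain.mul_size_lt (hC : NetworkChain A model T D n F) {b : ℝ} {i j : ℕ}
    (hb : b ≤ D i) (hij : i < j) : b * n i < n j := by
  have size_le : n i ≤ D j := (hC.size_le i).trans (hC.monotone hij)
  calc b * n i ≤ D j * D j := by
        refine mul_le_mul (hb.trans ?_) (by exact_mod_cast size_le) (by positivity) (by positivity)
        exact_mod_cast hC.monotone hij.le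
    _ < n j := by exact_mod_cast (by nlinarith [hC.mul_sq_le j, hC.three_le j] : D j * D j < n j)

theorem inv_pow_eight_le (n : ℕ) : ((n : ℝ≥0∞) ^ 8)⁻¹ ≤ (n : ℝ≥0∞)⁻¹ := by
  rcases n.eq_zero_or_pos with rfl | hn
  · simp
  · exact ENNReal.inv_le_inv.2 (le_self_pow₀ (by exact_mod_cast hn) (by norm_num))

variable {P : Criterion R M Out} {b : ℝ}

theorem NetworkChain.prob_loneTransmissionBefore_le (hC : NetworkChain A model T D n F) (i : ℕ) :
    prob (A.run model (n i) (D (i + 1))) (LoneTransmissionBefore (D i)) ≤ (n i : ℝ≥0∞)⁻¹ :=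
  calc _ ≤ (min (D (i + 1)) (D i) : ℕ) * (D i * ((n i : ℝ≥0∞) ^ 10)⁻¹) :=
        (hC.network i).predicts.prob_loneTransmissionBefore_le _
    _ ≤ ((n i : ℝ≥0∞) ^ 8)⁻¹ := by
        rw [min_eq_right (hC.monotone i.le_succ)]
        exact (hC.network i).mul_mul_error_le (hC.three_le i)
    _ ≤ (n i : ℝ≥0∞)⁻¹ := inv_pow_eight_le _

theorem NetworkChain.prob_oblivious_and_not_le (hC : NetworkChain A model T D n F)
    (hP : P.SizeSensitive b) (hA : A.Solves model P T) (i : ℕ) (F' : ℕ → Bool)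
    {G : History R M → Prop}
    (hG : ∀ σ, P A (n i) σ → ¬ LoneTransmissionBefore (D i) σ → ∀ s, G (σ s)) :
    prob (A.soloRun model F' (D (i + 1)) []) (fun h => Oblivious (F i) F' (D i) h ∧ ¬ G h) ≤
      (n i : ℝ≥0∞)⁻¹ + (n i : ℝ≥0∞)⁻¹ + (n i : ℝ≥0∞)⁻¹ := by
  classical
  have hN := hC.network i
  let s₀ : Fin (n i) := ⟨0, hC.size_pos i⟩
  calc prob (A.soloRun model F' (D (i + 1)) []) (fun h => Oblivious (F i) F' (D i) h ∧ ¬ G h)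
      = prob (A.soloRun model (F i) (D (i + 1)) [])
          (fun h => Oblivious (F i) F' (D i) h ∧ ¬ G h) := by
        simp only [prob_eq_expect_ite]
        exact (expect_soloRun_eq_of_oblivious _ fun h hh => if_neg fun H => hh H.1).symm
    _ ≤ prob (A.run model (n i) (D (i + 1)))
          (fun σ => Oblivious (F i) F' (D i) (σ s₀) ∧ ¬ G (σ s₀)) +
        D i * ((n i : ℝ≥0∞) ^ 10)⁻¹ := by
        simp only [prob_eq_expect_ite]
        exact hN.predicts.expect_oblivious_le (hC.monotone i.le_succ) s₀
          (fun h => by split_ifs <;> simp) fun h hh => if_neg fun H => hh H.1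
    _ ≤ prob (A.run model (n i) (D (i + 1)))
          (fun σ => ¬ P A (n i) σ ∨ LoneTransmissionBefore (D i) σ) + (n i : ℝ≥0∞)⁻¹ := by
        refine add_le_add (prob_mono fun σ _ hσ => ?_)
          ((hN.mul_error_le (hC.three_le i)).trans (inv_pow_eight_le _))
        by_contra! hnot
        exact hσ.2 (hG σ hnot.1 hnot.2 s₀)
    _ ≤ (n i : ℝ≥0∞)⁻¹ + (n i : ℝ≥0∞)⁻¹ + (n i : ℝ≥0∞)⁻¹ := by
        gcongr
        exact (prob_or_le _ _ _).trans (add_le_add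
          (hA.prob_not_le hP.terminates (hC.size_pos i) (hC.time_le i))
          (hC.prob_loneTransmissionBefore_le i))

theorem NetworkChain.prob_le_of_incompatible (hC : NetworkChain A model T D n F)
    (hP : P.SizeSensitive b) (hA : A.Solves model P T) {j t : ℕ} (ht : t ≤ D j)
    {G : History R M → Prop} (hG : ∀ h, G h → A.output h ≠ none)
    (hPG : ∀ σ, P A (n j) σ → ∀ s, ¬ G (σ s)) :
    prob (A.soloRun model (F j) t []) G ≤ (n j : ℝ≥0∞)⁻¹ + (n j : ℝ≥0∞)⁻¹ := by
  classical
  have hN := hC.network j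
  let s₀ : Fin (n j) := ⟨0, hC.size_pos j⟩
  have closed (σ : Fin (n j) → History R M) (hσ : G (σ s₀)) (σ')
      (hσ' : σ' ∈ (A.step model σ).support) : G (σ' s₀) := by
    rwa [eq_of_mem_support_step_of_terminal hσ' (hG _ hσ)]
  calc prob (A.soloRun model (F j) t []) G
      = prob (indep (n j) fun _ => A.soloRun model (F j) t []) (fun σ => G (σ s₀)) :=
        (prob_indep_apply (fun _ => A.soloRun model (F j) t []) s₀ G).symm
    _ ≤ prob (A.run model (n j) t) (fun σ => G (σ s₀)) + t * ((n j : ℝ≥0∞) ^ 10)⁻¹ := by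
        simp only [prob_eq_expect_ite]
        exact hN.predicts.le_expect_run ht fun σ => by split_ifs <;> simp
    _ ≤ prob (A.run model (n j) (D (j + 1))) (fun σ => ¬ P A (n j) σ) + (n j : ℝ≥0∞)⁻¹ := by
        refine add_le_add ((monotone_prob_run closed (ht.trans (hC.monotone j.le_succ))).trans
          (prob_mono fun σ _ hσ hPσ => hPG σ hPσ s₀ hσ)) ?_
        calc _ ≤ D j * ((n j : ℝ≥0∞) ^ 10)⁻¹ := by gcongr
          _ ≤ _ := (hN.mul_error_le (hC.three_le j)).trans (inv_pow_eight_le _)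
    _ ≤ (n j : ℝ≥0∞)⁻¹ + (n j : ℝ≥0∞)⁻¹ := by
        gcongr
        exact hA.prob_not_le hP.terminates (hC.size_pos j) (hC.time_le j)

/-- An oblivious device ends up in a state that is successful in network `i`, hence not in
network `j`. -/
theorem NetworkChain.pairProb_le (hC : NetworkChain A model T D n F) (hP : P.SizeSensitive b)
    (hA : A.Solves model P T) {i j : ℕ} (hb : b ≤ D i) (hij : i < j) :
    pairProb A model D F i j [] ≤ (5 : ℕ) * (n i : ℝ≥0∞)⁻¹ := by
  let Reachable (h : History R M) : Prop :=
    ∃ σ, P A (n i) σ ∧ ¬ LoneTransmissionBefore (D i) σ ∧ ∃ s, σ s = h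
  have reachable_le := hC.prob_oblivious_and_not_le hP hA i (F j) (G := Reachable)
    fun σ hσ hlone s => ⟨σ, hσ, hlone, s, rfl⟩
  have shared_le : prob (A.soloRun model (F j) (D (i + 1)) [])
      (fun h => Oblivious (F i) (F j) (D i) h ∧ Reachable h) ≤
        (n j : ℝ≥0∞)⁻¹ + (n j : ℝ≥0∞)⁻¹ := by
    refine hC.prob_le_of_incompatible hP hA (hC.monotone hij) ?_ ?_
    · rintro _ ⟨-, σ, hσ, -, s, rfl⟩
      exact hP.terminates hσ s
    · rintro σ' hσ' s' ⟨hobl, σ, hσ, hlone, s, hs⟩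
      exact hlone (hP.loneTransmissionBefore (hC.mul_size_lt hb hij) hσ hσ' hs (hs ▸ hobl))
  calc pairProb A model D F i j []
      ≤ prob (A.soloRun model (F j) (D (i + 1)) [])
          (fun h => (Oblivious (F i) (F j) (D i) h ∧ ¬ Reachable h) ∨
            (Oblivious (F i) (F j) (D i) h ∧ Reachable h)) :=
        prob_mono fun h _ hobl => by
          by_cases hR : Reachable h
          exacts [.inr ⟨hobl, hR⟩, .inl ⟨hobl, hR⟩]
    _ ≤ ((n i : ℝ≥0∞)⁻¹ + (n i : ℝ≥0∞)⁻¹ + (n i : ℝ≥0∞)⁻¹) +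
          ((n j : ℝ≥0∞)⁻¹ + (n j : ℝ≥0∞)⁻¹) :=
        (prob_or_le _ _ _).trans (add_le_add reachable_le shared_le)
    _ ≤ ((n i : ℝ≥0∞)⁻¹ + (n i : ℝ≥0∞)⁻¹ + (n i : ℝ≥0∞)⁻¹) +
          ((n i : ℝ≥0∞)⁻¹ + (n i : ℝ≥0∞)⁻¹) := by
        gcongr <;> exact hC.size_le_size hij
    _ = (5 : ℕ) * (n i : ℝ≥0∞)⁻¹ := by push_cast; ring

theorem exists_lt_of_one_le_potential {S : Finset ℕ} {K x : ℕ} (hK : S.card = K) {h : History R M}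
    (hpot : 1 ≤ potential A model D F S x h)
    (hpair : ∀ i ∈ S, ∀ j ∈ S, i < j →
      pairProb A model D F i j h ≤ ((2 * K ^ 2 : ℕ) : ℝ≥0∞)⁻¹) :
    ∃ i ∈ S, ((4 * K : ℕ) : ℝ≥0∞)⁻¹ < costProb A model D F i x h := by
  by_contra! hcost
  have pairs_le : ∑ ij ∈ S ×ˢ S with ij.1 < ij.2, pairProb A model D F ij.1 ij.2 h ≤ 2⁻¹ := by
    calc ∑ ij ∈ S ×ˢ S with ij.1 < ij.2, pairProb A model D F ij.1 ij.2 h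
        ≤ (Finset.card {ij ∈ S ×ˢ S | ij.1 < ij.2}) • ((2 * K ^ 2 : ℕ) : ℝ≥0∞)⁻¹ :=
          Finset.sum_le_card_nsmul _ _ _ fun ij hij => by
            simp only [Finset.mem_filter, Finset.mem_product] at hij
            exact hpair _ hij.1.1 _ hij.1.2 hij.2
      _ ≤ (K ^ 2 : ℕ) * ((2 * K ^ 2 : ℕ) : ℝ≥0∞)⁻¹ := by
          rw [nsmul_eq_mul]
          gcongr
          exact (Finset.card_filter_le _ _).trans (by rw [Finset.card_product, hK, sq])
      _ ≤ ((2 : ℕ) : ℝ≥0∞)⁻¹ := natCast_mul_inv_le (mul_comm _ _).le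
      _ = 2⁻¹ := by norm_num
  have costs_le : ∑ i ∈ S, costProb A model D F i x h ≤ 4⁻¹ := by
    refine (Finset.sum_le_card_nsmul _ _ _ hcost).trans ?_
    rw [nsmul_eq_mul, hK]
    exact natCast_mul_inv_le (mul_comm _ _).le
  refine absurd (hpot.trans (add_le_add pairs_le costs_le)) (not_le.2 ?_)
  calc (2⁻¹ + 4⁻¹ : ℝ≥0∞) < 2⁻¹ + 2⁻¹ :=
        ENNReal.add_lt_add_left (by simp) (ENNReal.inv_lt_inv.2 (by norm_num))
    _ = 1 := ENNReal.inv_two_add_inv_two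

theorem NetworkChain.exists_one_sub_le (hC : NetworkChain A model T D n F)
    (hP : P.SizeSensitive b) (hA : A.Solves model P T) {i₀ E : ℕ} (hb : b ≤ D i₀)
    (hE : 2 ^ E ≤ D i₀) :
    ∃ i, i₀ ≤ i ∧ i < i₀ + 2 ^ E ∧ 1 - ((n i : ℝ≥0∞) ^ 7)⁻¹ ≤
      prob (A.run model (n i) (D i)) (fun σ => ∃ s, E ≤ energy (σ s)) := by
  have card_eq : (Finset.Ico i₀ (i₀ + 2 ^ E)).card = 2 ^ E := by simp
  have hpot : 1 ≤ potential A model D F (Finset.Ico i₀ (i₀ + 2 ^ E)) E [] := by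
    have := one_le_potential (A := A) (model := model) (F := F) (h := []) hC.monotone
      (D (i₀ + 2 ^ E)) (S := Finset.Ico i₀ (i₀ + 2 ^ E)) (e := E)
      (fun i hi => by simpa using hC.monotone (Finset.mem_Ico.1 hi).2.le) card_eq.ge
      (fun i _ j _ _ t e he => by simp at he)
    simpa [energy] using this
  obtain ⟨i, hi, hcost⟩ := exists_lt_of_one_le_potential card_eq hpot fun i hi j _ hij => by
    have hDi : D i₀ ≤ D i := hC.monotone (Finset.mem_Ico.1 hi).1
    refine (hC.pairProb_le hP hA (hb.trans (by exact_mod_cast hDi)) hij).trans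
      (natCast_mul_inv_le ?_)
    have : (2 ^ E) ^ 2 ≤ D i ^ 2 := Nat.pow_le_pow_left (hE.trans hDi) 2
    linarith [hC.mul_sq_le i]
  obtain ⟨hi₀, hi⟩ := Finset.mem_Ico.1 hi
  exact ⟨i, hi₀, hi, (hC.network i).one_sub_le_prob_exists (hC.three_le i) (by positivity)
    (hE.trans (hC.monotone hi₀)) hcost.le⟩

end Chain

section Checkpoints

variable {R : Type u} {M : Type v} {Out : Type w} {T : ℕ → ℕ}

theorem strictMono_checkpoint (hT : ∀ n, n ≤ T n) (d : ℕ) : StrictMono (checkpoint T d) :=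
  strictMono_nat_of_lt_succ fun i => by
    have lt_two_pow_four (y : ℕ) : y < 2 ^ 2 ^ 2 ^ 2 ^ y :=
      Nat.lt_two_pow_self.trans (Nat.lt_two_pow_self.trans
        (Nat.lt_two_pow_self.trans Nat.lt_two_pow_self))
    exact (lt_two_pow_four _).trans_le (hT _)

theorem exists_networkChain_checkpoint (A : Algorithm R M Out) (model : CDModel)
    (hmono : Monotone T) (hT : ∀ n, n ≤ T n) {d : ℕ} (hd : 3 ≤ d) :
    ∃ n F, NetworkChain A model T (checkpoint T d) n F := by
  have hD := (strictMono_checkpoint hT d).monotone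
  have three_le (i : ℕ) : 3 ≤ checkpoint T d i := hd.trans (hD i.zero_le)
  choose n F hN using fun i => exists_predictableNetwork A model (three_le i)
  exact ⟨n, F, hD, three_le, hN, fun i => (hN i).le.trans (hT _), fun i => hmono (hN i).le⟩

theorem exists_two_pow_le_and_log_le {k : ℕ} (hk : 3 ≤ k) :
    ∃ E : ℕ, 2 * 2 ^ E ≤ k + 1 ∧ 1 / 4 * Real.log k ≤ E := by
  obtain ⟨E, hE⟩ : ∃ E, Nat.log 2 (k + 1) = E + 2 :=
    Nat.exists_eq_add_of_le' (Nat.le_log_of_pow_le one_lt_two (by omega))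
  refine ⟨E + 1, ?_, ?_⟩
  · rw [← pow_succ', ← hE]
    exact Nat.pow_log_le_self 2 k.succ_ne_zero
  · have k_le : (k : ℝ) ≤ 2 ^ (E + 3) := by
      have := Nat.lt_pow_succ_log_self one_lt_two (k + 1)
      rw [hE] at this
      exact_mod_cast (k.le_succ.trans this.le)
    have log_le := Real.log_le_log (by positivity) k_le
    rw [Real.log_pow] at log_le
    push_cast at log_le ⊢
    nlinarith [Real.log_two_lt_d9]

variable {P : Criterion R M Out} {b : ℝ} {A : Algorithm R M Out} {model : CDModel}

theorem Algorithm.prob_le_probEnergyAtLeast {n t E : ℕ} {x : ℝ} (hx : x ≤ E) :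
    prob (A.run model n t) (fun σ => ∃ s, E ≤ energy (σ s)) ≤ A.probEnergyAtLeast model n x :=
  (prob_mono fun _ _ ⟨s, hs⟩ => ⟨s, hx.trans (by exact_mod_cast hs)⟩).trans
    (le_iSup (fun t => prob (A.run model n t) fun σ => ∃ s, x ≤ (energy (σ s) : ℝ)) t)

theorem Algorithm.Solves.exists_le_probEnergyAtLeast (hA : A.Solves model P T)
    (hP : P.SizeSensitive b) (hmono : Monotone T) (hT : ∀ n, n ≤ T n) {d : ℕ} (hd : 3 ≤ d)
    (hb : b ≤ d) {k : ℕ} (hk : 3 ≤ k) {x : ℝ} (hx : x ≤ 1 / 4 * Real.log k) :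
    ∃ n, checkpoint T d 0 ≤ n ∧ n ≤ checkpoint T d k ∧
      1 - ((n : ℝ≥0∞) ^ 7)⁻¹ ≤ A.probEnergyAtLeast model n x := by
  have hD := strictMono_checkpoint hT d
  obtain ⟨n, F, hC⟩ := exists_networkChain_checkpoint A model hmono hT hd
  obtain ⟨E, hEk, hE⟩ := exists_two_pow_le_and_log_le hk
  have add_le : k - 2 ^ E + d ≤ checkpoint T d (k - 2 ^ E) := hD.add_le_nat (k - 2 ^ E) 0
  have d_le : d ≤ checkpoint T d (k - 2 ^ E) := (Nat.le_add_left _ _).trans add_le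
  obtain ⟨i, -, hi, henergy⟩ := hC.exists_one_sub_le hP hA (i₀ := k - 2 ^ E) (E := E)
    (hb.trans (by exact_mod_cast d_le)) (by omega)
  exact ⟨n i, (hD.monotone i.zero_le).trans (hC.le_size i),
    (hC.size_le i).trans (hD.monotone (by omega)),
    henergy.trans (Algorithm.prob_le_probEnergyAtLeast (hx.trans hE))⟩

end Checkpoints

section ExponentialTime

/-- The tower of twos of the given height, which is what the iterated logarithm inverts. -/
def tower : ℕ → ℕ
  | 0 => 1
  | m + 1 => 2 ^ tower m

theorem le_tower (m : ℕ) : m ≤ tower m := by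
  induction m with
  | zero => exact Nat.zero_le _
  | succ m ih => exact Nat.succ_le_of_lt (ih.trans_lt Nat.lt_two_pow_self)

theorem exists_iterate_logb_le_one {m : ℕ} {x : ℝ} (hx : x ≤ tower m) :
    ∃ k ≤ m, (Real.logb 2)^[k] x ≤ 1 := by
  induction m generalizing x with
  | zero => exact ⟨0, le_rfl, by simpa [tower] using hx⟩
  | succ m ih =>
    by_cases hx1 : x ≤ 1
    · exact ⟨0, Nat.zero_le _, hx1⟩
    · have logb_le : Real.logb 2 x ≤ tower m := by
        rw [Real.logb_le_iff_le_rpow one_lt_two (by linarith), Real.rpow_natCast]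
        simpa [tower] using hx
      obtain ⟨k, hk, hle⟩ := ih logb_le
      exact ⟨k + 1, by omega, by simpa using hle⟩

theorem logStar_le_of_le_tower {n m : ℕ} (h : n ≤ tower m) : logStar n ≤ m := by
  obtain ⟨k, hk, hle⟩ := exists_iterate_logb_le_one (m := m) (x := n) (by exact_mod_cast h)
  exact (Nat.sInf_le hle).trans hk

theorem checkpoint_max_two_pow_le_tower (d i : ℕ) :
    checkpoint (fun m => max d (2 ^ m)) d i ≤ tower (d + 5 * i) := by
  induction i with
  | zero => exact le_tower d
  | succ i ih =>
    refine max_le ((Nat.le_add_right _ _).trans (le_tower _)) ?_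
    change _ ≤ 2 ^ 2 ^ 2 ^ 2 ^ 2 ^ tower (d + 5 * i)
    gcongr <;> norm_num

theorem log_logStar_le {d k n : ℕ} (hk : d + 6 ≤ k)
    (hn : n ≤ checkpoint (fun m => max d (2 ^ m)) d (k + 1)) :
    Real.log (logStar n) ≤ 2 * Real.log k := by
  have logStar_le : logStar n ≤ k ^ 2 :=
    (logStar_le_of_le_tower (hn.trans (checkpoint_max_two_pow_le_tower d (k + 1)))).trans
      (by nlinarith)
  rcases (logStar n).eq_zero_or_pos with hzero | hpos
  · simpa [hzero] using Real.log_natCast_nonneg k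
  · calc Real.log (logStar n) ≤ Real.log ((k : ℝ) ^ 2) :=
          Real.log_le_log (by exact_mod_cast hpos) (by exact_mod_cast logStar_le)
      _ = 2 * Real.log k := by rw [Real.log_pow, Nat.cast_ofNat]

theorem exists_forall_le_max_two_pow {T : ℕ → ℕ} (hT : ∀ᶠ n in Filter.atTop, T n ≤ 2 ^ n) :
    ∃ C, ∀ n, T n ≤ max C (2 ^ n) := by
  obtain ⟨a, ha⟩ := Filter.eventually_atTop.1 hT
  refine ⟨(Finset.range a).sup T, fun n => le_max_iff.2 ?_⟩
  rcases lt_or_ge n a with hn | hn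
  exacts [.inl (Finset.le_sup (Finset.mem_range.2 hn)), .inr (ha n hn)]

theorem PolyTime.eventually_le_two_pow {T : ℕ → ℕ} (hT : PolyTime T) :
    ∀ᶠ n in Filter.atTop, T n ≤ 2 ^ n := by
  obtain ⟨p, hp⟩ := hT
  have eval_isLittleO : (fun n : ℕ => ((p.eval n : ℕ) : ℝ)) =o[Filter.atTop]
      fun n : ℕ => (2 : ℝ) ^ n := by
    simp only [Polynomial.eval_eq_sum_range, Nat.cast_sum, Nat.cast_mul, Nat.cast_pow]
    refine Asymptotics.IsLittleO.fun_sum fun i _ => ?_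
    exact (isLittleO_pow_const_const_pow_of_one_lt i one_lt_two).const_mul_left _
  filter_upwards [eval_isLittleO.bound one_pos] with n hn
  refine (hp n).trans ?_
  rw [one_mul, Real.norm_natCast, Real.norm_of_nonneg (by positivity)] at hn
  exact_mod_cast hn

variable {R : Type u} {M : Type v} {Out : Type w} {T : ℕ → ℕ} {P : Criterion R M Out} {b : ℝ}
  {A : Algorithm R M Out} {model : CDModel}

theorem Algorithm.Solves.energyCostAtLeast (hA : A.Solves model P T) (hP : P.SizeSensitive b)
    (hT : ∀ᶠ n in Filter.atTop, T n ≤ 2 ^ n) :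
    A.EnergyCostAtLeast model fun n => 1 / 8 * Real.log (logStar n) := by
  obtain ⟨C, hC⟩ := exists_forall_le_max_two_pow hT
  obtain ⟨d, hCd, hd, hb⟩ : ∃ d, C ≤ d ∧ 3 ≤ d ∧ b ≤ d :=
    ⟨max C (max 3 ⌈b⌉₊), by simp, by simp, Nat.ceil_le.1 (by simp)⟩
  set T' : ℕ → ℕ := fun m => max d (2 ^ m)
  have le_T' (n : ℕ) : n ≤ T' n := Nat.lt_two_pow_self.le.trans (le_max_right _ _)
  have monotone_T' : Monotone T' := fun m m' hm =>
    max_le_max le_rfl (Nat.pow_le_pow_right two_pos hm)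
  have hA' : A.Solves model P T' :=
    hA.mono hP.terminates fun n _ => (hC n).trans (max_le_max hCd le_rfl)
  have hD := strictMono_checkpoint le_T' d
  filter_upwards [Filter.eventually_gt_atTop (checkpoint T' d (d + 6))] with n hn
  obtain ⟨k, hkn, hnk⟩ := hD.exists_between_of_tendsto_atTop hD.tendsto_atTop
    ((hD.monotone (Nat.zero_le _)).trans_lt hn)
  have hk : d + 6 ≤ k := Nat.lt_succ_iff.1 (hD.lt_iff_lt.1 (hn.trans_le hnk))
  obtain ⟨n', hdn', hn'k, henergy⟩ := hA'.exists_le_probEnergyAtLeast hP monotone_T' le_T' hd hb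
    (k := k) (x := 1 / 8 * Real.log (logStar n)) (by omega)
    (by linarith [log_logStar_le hk hnk])
  exact ⟨n', (by omega : 2 ≤ d).trans hdn', hn'k.trans hkn.le, henergy⟩

end ExponentialTime

end RadioNet

end

theorem mainTheorem2_general {R : Type u} {M : Type v} {Out : Type w}
    {P : RadioNet.Criterion R M Out} {b : ℝ} (hP : P.SizeSensitive b)
    {A : RadioNet.Algorithm R M Out} {model : RadioNet.CDModel} {T : ℕ → ℕ}
    (hA : A.Solves model P T) :
    ((∀ᶠ n in Filter.atTop, T n ≤ 2 ^ n) →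
      A.EnergyCostAtLeast model fun n => 1 / 8 * Real.log (RadioNet.logStar n)) ∧
    (Monotone T → (∀ n, n ≤ T n) → ∀ d : ℕ, 3 ≤ d → b ≤ d → ∀ k : ℕ, 3 ≤ k →
      ∃ n : ℕ, RadioNet.checkpoint T d 0 ≤ n ∧ n ≤ RadioNet.checkpoint T d k ∧
        1 - ((n : ℝ≥0∞) ^ 7)⁻¹ ≤ A.probEnergyAtLeast model n (1 / 8 * Real.log k)) :=
  ⟨hA.energyCostAtLeast hP, fun hmono hT _ hd hb k hk =>
    hA.exists_le_probEnergyAtLeast hP hmono hT hd hb hk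
      (by linarith [Real.log_natCast_nonneg k])⟩

theorem mainTheorem2 :
    ∃ κ : ℝ, 0 < κ ∧
      -- polynomial time Approximate Counting
      (∀ (R : Type u) (M : Type v) (model : RadioNet.CDModel) (A : RadioNet.Algorithm R M ℝ)
        (c : ℝ) (T : ℕ → ℕ), 1 ≤ c → RadioNet.PolyTime T →
        A.Solves model (RadioNet.ApproximateCounting c) T →
        A.EnergyCostAtLeast model fun n => κ * Real.log (RadioNet.logStar n)) ∧
      -- polynomial time Leader Election
      (∀ (R : Type u) (M : Type v) (model : RadioNet.CDModel)
        (A : RadioNet.Algorithm R M RadioNet.Role) (T : ℕ → ℕ), RadioNet.PolyTime T →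
        A.Solves model RadioNet.LeaderElection T →
        A.EnergyCostAtLeast model fun n => κ * Real.log (RadioNet.logStar n)) ∧
      -- polynomial time contention resolution
      (∀ (R : Type u) (M : Type v) (Out : Type w) (model : RadioNet.CDModel)
        (A : RadioNet.Algorithm R M Out) (T : ℕ → ℕ), RadioNet.PolyTime T →
        A.Solves model RadioNet.ContentionResolution T →
        A.EnergyCostAtLeast model fun n => κ * Real.log (RadioNet.logStar n)) ∧
      -- the detailed form, for Approximate Counting with an arbitrary time bound
      (∀ c : ℝ, 1 ≤ c → ∃ D : ℕ, ∀ d : ℕ, D ≤ d →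
        ∀ (R : Type u) (M : Type v) (model : RadioNet.CDModel) (A : RadioNet.Algorithm R M ℝ)
          (T : ℕ → ℕ), Monotone T → (∀ n, n ≤ T n) →
          A.Solves model (RadioNet.ApproximateCounting c) T →
          ∀ k : ℕ, 3 ≤ k → ∃ n : ℕ,
            RadioNet.checkpoint T d 0 ≤ n ∧ n ≤ RadioNet.checkpoint T d k ∧
            1 - ((n : ℝ≥0∞) ^ 7)⁻¹ ≤ A.probEnergyAtLeast model n (κ * Real.log k)) := by
  refine ⟨1 / 8, by norm_num, ?_, ?_, ?_, fun c hc => ⟨max 3 ⌈c ^ 2⌉₊, ?_⟩⟩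
  · intro R M model A c T hc hT hA
    exact (mainTheorem2_general (RadioNet.sizeSensitive_approximateCounting hc) hA).1
      hT.eventually_le_two_pow
  · intro R M model A T hT hA
    exact (mainTheorem2_general RadioNet.sizeSensitive_leaderElection hA).1
      hT.eventually_le_two_pow
  · intro R M Out model A T hT hA
    exact (mainTheorem2_general RadioNet.sizeSensitive_contentionResolution hA).1
      hT.eventually_le_two_pow
  · intro d hd R M model A T hmono hT hA k hk
    exact (mainTheorem2_general (RadioNet.sizeSensitive_approximateCounting hc) hA).2 hmono hT d
      ((le_max_left _ _).trans hd) (Nat.ceil_le.1 ((le_max_right _ _).trans hd)) k hk
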